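/- Let $F$ be a distribution function on $\mathbb R$ with finite second moment. Let $X_1,X_2,\dots$ be i.i.d. with distribution function $F$, put $X_{i:i}=\max\{X_1,\dots,X_i\}$ and $Z_i=X_{i+1:i+1}-X_{i:i}$, and assume that $F$ belongs to the class NCP, i.e. $\mathrm{Cov}[Z_i,Z_j]\le 0$ for all $i\ne j$, $i,j\ge 1$. Let $\omega=\inf\{x\in\mathbb R: F(x)=1\}$ (with $\omega=+\infty$ if $F<1$ everywhere). Suppose that $\lim_{x\to\omega-}F(x)=1$ (so in particular $F$ is non-degenerate) and that $F$ is differentiable, with derivative $f=F'$, on $(M,\omega)$ for some real $M<\omega$. For $\delta,\gamma\in\mathbb R$ put $$L(x;\delta,\gamma)=\frac{f(x)}{(1-F(x))^{\gamma}\,(-\log(1-F(x)))^{\delta}} .$$ Suppose that $$0<\liminf_{x\to\omega-}L(x;\delta,\gamma)\le\limsup_{x\to\omega-}L(x;\delta,\gamma)<+\infty$$ either (i) with $\delta=0$ and some $\gamma<3/2$, or (ii) with some $\delta>0$ and some $\gamma$ such that $1/2<\gamma\le 1$. For $n\ge 2$ consider the estimators $\sum_{i=1}^n c_iX^*_{i:i}$,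 linear in the partial maxima $X^*_{i:i}=\max\{X^*_1,\dots,X^*_i\}$ of an i.i.d. sample $X^*_1,X^*_2,\dots$ from $F((\cdot-\theta_1)/\theta_2)$, where $\theta_1\in\mathbb R$ and $\theta_2>0$ are unknown. With $\mu_i=\mathbb E[X_{i:i}]$, $\Sigma_{ij}=\mathrm{Cov}[X_{i:i},X_{j:j}]$ $(1\le i,j\le n)$, $\mathbf 1=(1,\dots,1)'$, $\Gamma=\Sigma^{-1}(\mathbf 1\mu'-\mu\mathbf 1')\Sigma^{-1}$ and $\Delta=(\mathbf 1'\Sigma^{-1}\mathbf 1)(\mu'\Sigma^{-1}\mu)-(\mathbf 1'\Sigma^{-1}\mu)^2$, let $$L_2=L_{2,n}=\frac1\Delta\,\mathbf 1'\Gamma\,(X^*_{1:1},\dots,X^*_{n:n})' .$$ Then, for every $n\ge2$, $L_{2,n}$ is the unique best linear unbiased estimator (BLUE) of $\theta_2$ based on $X^*_{1:1},\dots,X^*_{n:n}$, that is, the unique coefficient vector $c$ for which the estimator is unbiased for $\theta_2$ and has, for all $\theta_1\in\mathbb R$ and $\theta_2>0$, the smallest variance among all such unbiased linear estimators. Moreover,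 for all $\theta_1\in\mathbb R$ and $\theta_2>0$, the sequence $L_{2,n}$ is consistent, i.e. $L_{2,n}\to\theta_2$ in probability as $n\to\infty$, and $\mathrm{Var}[L_{2,n}]=O(1/\log n)$ as $n\to\infty$. -/

import Mathlib

open MeasureTheory ProbabilityTheory Filter Topology Asymptotics
open scoped Matrix

namespace PartialMaxima

noncomputable section

/-- The law of an infinite i.i.d. sample `X₁, X₂, …` from the distribution `P`
(the coordinate `x k` of a point `x : ℕ → ℝ` is the observation `X_{k+1}`). -/
def sampleLaw (P : Measure ℝ) : Measure (ℕ → ℝ) :=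
  Measure.infinitePi (fun _ : ℕ => P)

/-- The partial maximum `max (x 0) … (x k)`, that is, `X_{k+1:k+1}`. -/
def partialMax (k : ℕ) (x : ℕ → ℝ) : ℝ :=
  partialSups x k

/-- The partial maxima spacing `Z_{k+1} = X_{k+2:k+2} - X_{k+1:k+1}`. -/
def spacing (k : ℕ) (x : ℕ → ℝ) : ℝ :=
  partialMax (k + 1) x - partialMax k x

/-- The class NCP: finite second moment, and any two distinct partial maxima spacings of an
i.i.d. sample are non-positively correlated. -/
structure NCP (P : Measure ℝ) : Prop where
  memLp_two : MemLp (fun x : ℝ => x) 2 P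
  cov_nonpos : ∀ i j : ℕ, i ≠ j → cov[spacing i, spacing j; sampleLaw P] ≤ 0

/-- The upper end-point `inf {x : F x = 1}` of the support, equal to `⊤` if `F < 1` everywhere. -/
def upperEndpoint (P : Measure ℝ) : EReal :=
  sInf ((fun x : ℝ => (x : EReal)) '' {x : ℝ | cdf P x = 1})

/-- The filter on `ℝ` of `x → ω-`, where `ω : EReal` (it is `atTop` if `ω = ⊤`). -/
def leftOf (ω : EReal) : Filter ℝ :=
  comap (fun x : ℝ => (x : EReal)) (𝓝[<] ω)

/-- The generalized hazard rate `f / ((1 - F) ^ γ * (-log (1 - F)) ^ δ)`, where `f = F'`. -/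
def genHazard (P : Measure ℝ) (δ γ x : ℝ) : ℝ :=
  deriv (cdf P) x / ((1 - cdf P x) ^ γ * (-Real.log (1 - cdf P x)) ^ δ)

/-- The member of the location-scale family generated by `P` with location `θ₁` and
scale `θ₂ > 0`: the law of `θ₁ + θ₂ X`, where `X` has law `P`. -/
def locationScale (P : Measure ℝ) (θ₁ θ₂ : ℝ) : Measure ℝ :=
  P.map (fun x => θ₁ + θ₂ * x)

/-- The distribution function of `locationScale P θ₁ θ₂` is `F ((t - θ₁) / θ₂)`. -/
theorem cdf_locationScale (P : Measure ℝ) [IsProbabilityMeasure P] (θ₁ θ₂ : ℝ) (h : 0 < θ₂)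
    (t : ℝ) : cdf (locationScale P θ₁ θ₂) t = cdf P ((t - θ₁) / θ₂) := by
  have hm : Measurable (fun x : ℝ => θ₁ + θ₂ * x) := by fun_prop
  have : IsProbabilityMeasure (locationScale P θ₁ θ₂) :=
    Measure.isProbabilityMeasure_map hm.aemeasurable
  rw [cdf_eq_real, cdf_eq_real, locationScale, map_measureReal_apply hm measurableSet_Iic]
  congr 1
  ext x
  simp only [Set.mem_preimage, Set.mem_Iic, le_div_iff₀ h]
  constructor <;> intro hx <;> nlinarith

/-- The linear statistic `∑ cᵢ X_{i:i}` of the first `n` partial maxima. -/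
def linearStat {n : ℕ} (c : Fin n → ℝ) (x : ℕ → ℝ) : ℝ :=
  ∑ i : Fin n, c i * partialMax i x

/-- The linear estimator with coefficients `c` is unbiased for the scale parameter `θ₂`. -/
def IsUnbiasedScale (P : Measure ℝ) {n : ℕ} (c : Fin n → ℝ) : Prop :=
  ∀ θ₁ θ₂ : ℝ, 0 < θ₂ →
    ∫ x, linearStat c x ∂(sampleLaw (locationScale P θ₁ θ₂)) = θ₂

/-- The linear estimator with coefficients `c` is a best linear unbiased estimator of the scale
parameter based on the first `n` partial maxima. -/
def IsScaleBLUE (P : Measure ℝ) {n : ℕ} (c : Fin n → ℝ) : Prop :=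
  IsUnbiasedScale P c ∧
    ∀ c' : Fin n → ℝ, IsUnbiasedScale P c' → ∀ θ₁ θ₂ : ℝ, 0 < θ₂ →
      Var[linearStat c; sampleLaw (locationScale P θ₁ θ₂)] ≤
        Var[linearStat c'; sampleLaw (locationScale P θ₁ θ₂)]

/-- The mean vector `μ` of the first `n` partial maxima from `P`. -/
def meanVec (P : Measure ℝ) (n : ℕ) : Fin n → ℝ :=
  fun i => ∫ x, partialMax i x ∂(sampleLaw P)

/-- The dispersion matrix `Σ` of the first `n` partial maxima from `P`. -/
def dispMat (P : Measure ℝ) (n : ℕ) : Matrix (Fin n) (Fin n) ℝ :=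
  Matrix.of fun i j => cov[partialMax i, partialMax j; sampleLaw P]

/-- `Δ = (1' Σ⁻¹ 1) (μ' Σ⁻¹ μ) - (1' Σ⁻¹ μ) ^ 2`. -/
def blueDelta (P : Measure ℝ) (n : ℕ) : ℝ :=
  ((1 : Fin n → ℝ) ⬝ᵥ ((dispMat P n)⁻¹ *ᵥ 1)) *
      (meanVec P n ⬝ᵥ ((dispMat P n)⁻¹ *ᵥ meanVec P n)) -
    ((1 : Fin n → ℝ) ⬝ᵥ ((dispMat P n)⁻¹ *ᵥ meanVec P n)) ^ 2

/-- `Γ = Σ⁻¹ (1 μ' - μ 1') Σ⁻¹`. -/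
def blueGamma (P : Measure ℝ) (n : ℕ) : Matrix (Fin n) (Fin n) ℝ :=
  (dispMat P n)⁻¹ * (Matrix.vecMulVec 1 (meanVec P n) - Matrix.vecMulVec (meanVec P n) 1) *
    (dispMat P n)⁻¹

/-- The coefficient vector `Δ⁻¹ 1' Γ` of the partial maxima estimator `L₂ = Δ⁻¹ 1' Γ X*`. -/
def scaleCoeff (P : Measure ℝ) (n : ℕ) : Fin n → ℝ :=
  (blueDelta P n)⁻¹ • ((1 : Fin n → ℝ) ᵥ* blueGamma P n)

/-- The partial maxima estimator `L₂` of the scale parameter, based on the first `n` partial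
maxima of the data `x`. -/
def scaleEstimator (P : Measure ℝ) (n : ℕ) (x : ℕ → ℝ) : ℝ :=
  linearStat (scaleCoeff P n) x

end

end PartialMaxima

/-!
The estimator `L₂` is the Gauss-Markov solution: unbiasedness for `θ₂` means `c ⬝ 1 = 0` and
`c ⬝ μ = 1`, the variance is `θ₂²` times the quadratic form of `Σ`, and `Σ L₂` lies in the span of
`1` and `μ`, so that `L₂` is the unique minimiser as soon as `Σ` is positive definite and `μ` is not
constant (`scaleCoeff_feasible_and_min`). Positive definiteness (`posDef_dispMat`) holds because `F`
is strictly increasing to the left of `ω`: a linear statistic of zero variance is continuous and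
almost surely constant, hence constant at all samples from an interval to the left of `ω`, which
forces its coefficients to vanish.

For the rate, `L₂` is compared with an unbiased combination `∑ wₖ Zₖ` of the spacings, `wₖ ≥ 0`.
Under NCP its variance is at most `∑ wₖ² E Zₖ²` (`NCP.variance_sum_spacing_le`), and with `wₖ`
proportional to `1 / ((k + 1) E Zₖ)` this is `O(1 / log n)` once `E Zₖ² ≤ K (k + 1) (E Zₖ)²` for
large `k` (`RegularTail.exists_integral_spacing_sq_le`). Consistency then follows from Chebyshev's
inequality.

The moment inequality comes from `E Zₖ = ∫ F^(k+1) (1 - F)` and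
`E Zₖ² = 2 ∫ F(y)^(k+1) ∫_y^∞ (1 - F(z)) dz dy`. Near `ω` the density is comparable to
`φ (1 - F)` with `φ t = t^γ (-log t)^δ`, and the substitution `t = 1 - F` turns the two integrals,
with `N = k + 1`, into Laplace type integrals of orders `N^(γ - 2) (log N)^(-δ)` (a lower bound
suffices) and `N^(2 γ - 3) (log N)^(-2 δ)` (an upper bound suffices); the second exists for
`γ < 3 / 2`. The argument is the same in both cases of the theorem: it only uses `δ ≥ 0` and
`γ < 3 / 2`.
-/

namespace PartialMaxima

/-! ### Partial maxima and the location-scale family -/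

lemma partialMax_succ (k : ℕ) (x : ℕ → ℝ) :
    partialMax (k + 1) x = max (partialMax k x) (x (k + 1)) := by
  simp [partialMax, partialSups_add_one]

lemma partialMax_zero (x : ℕ → ℝ) : partialMax 0 x = x 0 := by
  simp [partialMax]

lemma partialMax_le_iff {k : ℕ} {x : ℕ → ℝ} {a : ℝ} :
    partialMax k x ≤ a ↔ ∀ i ≤ k, x i ≤ a := by
  simp [partialMax, partialSups_le_iff]

lemma partialMax_affine {θ₁ θ₂ : ℝ} (h : 0 ≤ θ₂) (k : ℕ) (x : ℕ → ℝ) :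
    partialMax k (fun i => θ₁ + θ₂ * x i) = θ₁ + θ₂ * partialMax k x := by
  induction k with
  | zero => simp [partialMax_zero]
  | succ k ih => rw [partialMax_succ, partialMax_succ, ih, mul_max_of_nonneg _ _ h, add_max]

lemma continuous_partialMax (k : ℕ) : Continuous (partialMax k) := by
  induction k with
  | zero => simpa only [funext partialMax_zero] using continuous_apply 0
  | succ k ih =>
    simp only [funext (partialMax_succ k)]
    exact ih.max (continuous_apply _)

lemma measurable_partialMax (k : ℕ) : Measurable (partialMax k) :=
  (continuous_partialMax k).measurable

lemma continuous_linearStat {n : ℕ} (c : Fin n → ℝ) : Continuous (linearStat c) := by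
  unfold linearStat
  exact continuous_finsetSum _ fun i _ => continuous_const.mul (continuous_partialMax i)

lemma spacing_eq (k : ℕ) (x : ℕ → ℝ) :
    spacing k x = max (x (k + 1) - partialMax k x) 0 := by
  rw [spacing, partialMax_succ, max_comm, ← max_sub_sub_right, sub_self]

lemma spacing_nonneg (k : ℕ) (x : ℕ → ℝ) : 0 ≤ spacing k x := by
  rw [spacing_eq]; exact le_max_right _ _

lemma measurable_spacing (k : ℕ) : Measurable (spacing k) :=
  (measurable_partialMax (k + 1)).sub (measurable_partialMax k)

lemma linearStat_affine {θ₁ θ₂ : ℝ} (h : 0 ≤ θ₂) {n : ℕ} (c : Fin n → ℝ) (x : ℕ → ℝ) :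
    linearStat c (fun i => θ₁ + θ₂ * x i) = θ₁ * ∑ i, c i + θ₂ * linearStat c x := by
  simp only [linearStat, partialMax_affine h, Finset.mul_sum, ← Finset.sum_add_distrib]
  exact Finset.sum_congr rfl fun i _ => by ring

section Law

variable {P : Measure ℝ} [IsProbabilityMeasure P]

instance : IsProbabilityMeasure (sampleLaw P) := by
  unfold sampleLaw; infer_instance

lemma memLp_partialMax (h : MemLp (fun x : ℝ => x) 2 P) (k : ℕ) :
    MemLp (partialMax k) 2 (sampleLaw P) := by
  have hc (i : ℕ) : MemLp (fun x : ℕ → ℝ => x i) 2 (sampleLaw P) :=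
    h.comp_measurePreserving (measurePreserving_eval_infinitePi (fun _ : ℕ => P) i)
  induction k with
  | zero => simpa only [funext partialMax_zero] using hc 0
  | succ k ih =>
    rw [show partialMax (k + 1) = partialMax k ⊔ fun x => x (k + 1) from
      funext (partialMax_succ k)]
    exact ih.sup (hc (k + 1))

lemma memLp_spacing (h : MemLp (fun x : ℝ => x) 2 P) (k : ℕ) :
    MemLp (spacing k) 2 (sampleLaw P) :=
  (memLp_partialMax h (k + 1)).sub (memLp_partialMax h k)

lemma memLp_linearStat (h : MemLp (fun x : ℝ => x) 2 P) {n : ℕ} (c : Fin n → ℝ) :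
    MemLp (linearStat c) 2 (sampleLaw P) :=
  memLp_finsetSum _ fun i _ => (memLp_partialMax h i).const_mul (c i)

lemma sampleLaw_locationScale (θ₁ θ₂ : ℝ) :
    sampleLaw (locationScale P θ₁ θ₂) =
      (sampleLaw P).map (fun x k => θ₁ + θ₂ * x k) := by
  unfold sampleLaw locationScale
  rw [Measure.infinitePi_map_pi (fun _ => P) (f := fun _ x => θ₁ + θ₂ * x) (by fun_prop)]

lemma measurable_affine (θ₁ θ₂ : ℝ) :
    Measurable (fun (x : ℕ → ℝ) k => θ₁ + θ₂ * x k) := by fun_prop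

lemma integral_linearStat (h : MemLp (fun x : ℝ => x) 2 P) {n : ℕ} (c : Fin n → ℝ) :
    ∫ x, linearStat c x ∂(sampleLaw P) = c ⬝ᵥ meanVec P n := by
  simp only [linearStat, dotProduct, meanVec]
  rw [integral_finsetSum]
  · simp only [integral_const_mul]
  · exact fun i _ => ((memLp_partialMax h i).integrable one_le_two).const_mul _

lemma integral_linearStat_locationScale (h : MemLp (fun x : ℝ => x) 2 P) {n : ℕ}
    (c : Fin n → ℝ) (θ₁ : ℝ) {θ₂ : ℝ} (hθ : 0 < θ₂) :
    ∫ x, linearStat c x ∂(sampleLaw (locationScale P θ₁ θ₂)) =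
      θ₁ * ∑ i, c i + θ₂ * (c ⬝ᵥ meanVec P n) := by
  rw [sampleLaw_locationScale, integral_map (measurable_affine _ _).aemeasurable
    (continuous_linearStat c).aestronglyMeasurable]
  simp only [linearStat_affine hθ.le]
  rw [integral_add (integrable_const _)
    (((memLp_linearStat h c).integrable one_le_two).const_mul _), integral_const, integral_const_mul,
    integral_linearStat h]
  simp

lemma variance_linearStat_locationScale {n : ℕ}
    (c : Fin n → ℝ) (θ₁ : ℝ) {θ₂ : ℝ} (hθ : 0 < θ₂) :
    Var[linearStat c; sampleLaw (locationScale P θ₁ θ₂)] =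
      θ₂ ^ 2 * Var[linearStat c; sampleLaw P] := by
  rw [sampleLaw_locationScale, variance_map (continuous_linearStat c).aemeasurable
    (measurable_affine _ _).aemeasurable]
  have : linearStat c ∘ (fun (x : ℕ → ℝ) k => θ₁ + θ₂ * x k) =
      fun x => θ₁ * ∑ i, c i + θ₂ * linearStat c x := funext fun x => linearStat_affine hθ.le c x
  rw [this, variance_const_add
    ((continuous_linearStat c).aestronglyMeasurable.const_mul _), variance_const_mul]

lemma variance_linearStat (h : MemLp (fun x : ℝ => x) 2 P) {n : ℕ} (c : Fin n → ℝ) :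
    Var[linearStat c; sampleLaw P] = c ⬝ᵥ (dispMat P n *ᵥ c) := by
  unfold linearStat
  rw [variance_fun_sum fun i : Fin n => (memLp_partialMax h i).const_mul (c i)]
  simp only [covariance_const_mul_left, covariance_const_mul_right, dotProduct, Matrix.mulVec,
    dispMat, Matrix.of_apply, Finset.mul_sum]
  exact Finset.sum_congr rfl fun i _ => Finset.sum_congr rfl fun j _ => by ring

lemma isUnbiasedScale_iff (h : MemLp (fun x : ℝ => x) 2 P) {n : ℕ} (c : Fin n → ℝ) :
    IsUnbiasedScale P c ↔ c ⬝ᵥ 1 = 0 ∧ c ⬝ᵥ meanVec P n = 1 := by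
  have key (θ₁ θ₂ : ℝ) (hθ : 0 < θ₂) := integral_linearStat_locationScale h c θ₁ hθ
  simp only [dotProduct_one]
  constructor
  · intro hu
    have h0 := hu 0 1 one_pos
    have h1 := hu 1 1 one_pos
    rw [key _ _ one_pos] at h0 h1
    constructor <;> linarith
  · rintro ⟨h0, h1⟩ θ₁ θ₂ hθ
    rw [key _ _ hθ, h0, h1]; ring

/-- Comparing variances for all parameters is comparing the quadratic forms of the dispersion
matrix. -/
lemma isScaleBLUE_iff (h : MemLp (fun x : ℝ => x) 2 P) {n : ℕ} (c : Fin n → ℝ) :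
    IsScaleBLUE P c ↔ (c ⬝ᵥ 1 = 0 ∧ c ⬝ᵥ meanVec P n = 1) ∧
      ∀ c' : Fin n → ℝ, c' ⬝ᵥ 1 = 0 → c' ⬝ᵥ meanVec P n = 1 →
        c ⬝ᵥ (dispMat P n *ᵥ c) ≤ c' ⬝ᵥ (dispMat P n *ᵥ c') := by
  unfold IsScaleBLUE
  rw [isUnbiasedScale_iff h]
  refine and_congr_right fun _ => forall_congr' fun c' => ?_
  rw [isUnbiasedScale_iff h, and_imp]
  refine forall_congr' fun _ => forall_congr' fun _ => ?_
  simp only [← variance_linearStat h]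
  constructor
  · intro hv
    have := hv 0 1 one_pos
    rwa [variance_linearStat_locationScale _ _ one_pos,
      variance_linearStat_locationScale _ _ one_pos, one_pow, one_mul, one_mul] at this
  · intro hv θ₁ θ₂ hθ
    rw [variance_linearStat_locationScale _ _ hθ, variance_linearStat_locationScale _ _ hθ]
    gcongr

end Law

/-! ### The best linear unbiased estimator -/

/-- `Δ⁻¹ 1' Γ` is, up to the factor `Δ⁻¹`, the combination
`(1' Σ⁻¹ 1) Σ⁻¹ μ - (1' Σ⁻¹ μ) Σ⁻¹ 1`. -/
lemma scaleCoeff_eq (P : Measure ℝ) (n : ℕ) (hS : (dispMat P n)⁻¹.IsSymm) :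
    scaleCoeff P n = (blueDelta P n)⁻¹ •
      (((1 : Fin n → ℝ) ⬝ᵥ ((dispMat P n)⁻¹ *ᵥ 1)) • ((dispMat P n)⁻¹ *ᵥ meanVec P n) -
        ((1 : Fin n → ℝ) ⬝ᵥ ((dispMat P n)⁻¹ *ᵥ meanVec P n)) • ((dispMat P n)⁻¹ *ᵥ 1)) := by
  have hv (v : Fin n → ℝ) : v ᵥ* (dispMat P n)⁻¹ = (dispMat P n)⁻¹ *ᵥ v := by
    rw [← Matrix.mulVec_transpose, hS.eq]
  rw [scaleCoeff, blueGamma, ← Matrix.vecMul_vecMul, ← Matrix.vecMul_vecMul,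
    Matrix.vecMul_sub, Matrix.vecMul_vecMulVec, Matrix.vecMul_vecMulVec,
    ← Matrix.dotProduct_mulVec, ← Matrix.dotProduct_mulVec, hv, Matrix.mulVec_sub,
    Matrix.mulVec_smul, Matrix.mulVec_smul]

/-- Gauss-Markov: under a positive definite dispersion matrix and a mean vector which is not
constant, `Δ⁻¹ 1' Γ` is feasible and it is the unique minimiser of the variance. The reason is that
`Σ c` lies in the span of `1` and `μ`, so that it annihilates differences of feasible vectors. -/
lemma scaleCoeff_feasible_and_min {P : Measure ℝ} {n : ℕ} (hS : (dispMat P n).PosDef)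
    (hμ : ∀ r : ℝ, meanVec P n ≠ r • 1) (hn : 0 < n) :
    (scaleCoeff P n ⬝ᵥ 1 = 0 ∧ scaleCoeff P n ⬝ᵥ meanVec P n = 1) ∧
      ∀ c : Fin n → ℝ, c ⬝ᵥ 1 = 0 → c ⬝ᵥ meanVec P n = 1 →
        c ⬝ᵥ (dispMat P n *ᵥ c) =
          scaleCoeff P n ⬝ᵥ (dispMat P n *ᵥ scaleCoeff P n) +
          (c - scaleCoeff P n) ⬝ᵥ (dispMat P n *ᵥ (c - scaleCoeff P n)) := by
  have hinv : (dispMat P n)⁻¹.PosDef := hS.inv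
  have hSs : (dispMat P n).IsSymm := by simpa using hS.isHermitian
  have hsymm : (dispMat P n)⁻¹.IsSymm := by simpa using hinv.isHermitian
  have hunit : IsUnit (dispMat P n).det := hS.det_pos.ne'.isUnit
  have hpos (v : Fin n → ℝ) (hv : v ≠ 0) : 0 < v ⬝ᵥ ((dispMat P n)⁻¹ *ᵥ v) := by
    simpa using hinv.dotProduct_mulVec_pos hv
  have hsc := scaleCoeff_eq P n hsymm
  have hΔdef : blueDelta P n = ((1 : Fin n → ℝ) ⬝ᵥ ((dispMat P n)⁻¹ *ᵥ 1)) *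
      (meanVec P n ⬝ᵥ ((dispMat P n)⁻¹ *ᵥ meanVec P n)) -
    ((1 : Fin n → ℝ) ⬝ᵥ ((dispMat P n)⁻¹ *ᵥ meanVec P n)) ^ 2 := rfl
  have hcomm (A : Matrix (Fin n) (Fin n) ℝ) (hA : A.IsSymm) (u v : Fin n → ℝ) :
      u ⬝ᵥ (A *ᵥ v) = v ⬝ᵥ (A *ᵥ u) := by
    rw [Matrix.dotProduct_mulVec, ← Matrix.mulVec_transpose, hA.eq, dotProduct_comm]
  have hd1 := hcomm _ hsymm (meanVec P n) 1
  have ha : 0 < (1 : Fin n → ℝ) ⬝ᵥ ((dispMat P n)⁻¹ *ᵥ 1) := by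
    refine hpos 1 fun h => ?_
    simpa using congrFun h ⟨0, hn⟩
  set S := dispMat P n
  set μ := meanVec P n
  set a := (1 : Fin n → ℝ) ⬝ᵥ (S⁻¹ *ᵥ 1)
  set b := μ ⬝ᵥ (S⁻¹ *ᵥ μ)
  set d := (1 : Fin n → ℝ) ⬝ᵥ (S⁻¹ *ᵥ μ)
  -- `a * Δ` is the value of the quadratic form at `a μ - d 1`, which does not vanish
  have hΔ : 0 < blueDelta P n := by
    have hv : a • μ - d • (1 : Fin n → ℝ) ≠ 0 := by
      intro h
      apply hμ (a⁻¹ * d)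
      rw [sub_eq_zero] at h
      rw [mul_smul, ← h, smul_smul, inv_mul_cancel₀ ha.ne', one_smul]
    have h1 := hpos _ hv
    have h2 : (a • μ - d • (1 : Fin n → ℝ)) ⬝ᵥ (S⁻¹ *ᵥ (a • μ - d • (1 : Fin n → ℝ))) =
        a * blueDelta P n := by
      simp only [Matrix.mulVec_sub, Matrix.mulVec_smul, dotProduct_sub, sub_dotProduct,
        smul_dotProduct, dotProduct_smul, smul_eq_mul, hΔdef, hd1]
      change a * (a * b - d * d) - d * (a * d - d * a) = _
      ring
    rw [h2] at h1
    exact pos_of_mul_pos_right h1 ha.le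
  have hc1 : scaleCoeff P n ⬝ᵥ 1 = 0 := by
    rw [hsc, dotProduct_comm]
    simp only [dotProduct_sub, dotProduct_smul, smul_eq_mul]
    change _ * (a * d - d * a) = 0
    ring
  have hc2 : scaleCoeff P n ⬝ᵥ μ = 1 := by
    rw [hsc, dotProduct_comm]
    simp only [dotProduct_sub, dotProduct_smul, smul_eq_mul, hd1]
    change _ * (a * b - d * d) = 1
    rw [← sq, ← hΔdef, inv_mul_cancel₀ hΔ.ne']
  have hSc : S *ᵥ scaleCoeff P n = (blueDelta P n)⁻¹ • (a • μ - d • (1 : Fin n → ℝ)) := by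
    rw [hsc, Matrix.mulVec_smul, Matrix.mulVec_sub, Matrix.mulVec_smul, Matrix.mulVec_smul,
      Matrix.mulVec_mulVec, Matrix.mulVec_mulVec, Matrix.mul_nonsing_inv _ hunit,
      Matrix.one_mulVec, Matrix.one_mulVec]
  refine ⟨⟨hc1, hc2⟩, fun c h1 h2 => ?_⟩
  have hcross : c ⬝ᵥ (S *ᵥ scaleCoeff P n) =
      scaleCoeff P n ⬝ᵥ (S *ᵥ scaleCoeff P n) := by
    rw [hSc]
    simp only [dotProduct_sub, dotProduct_smul, h1, h2, hc1, hc2]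
  have hcross' := hcomm S hSs (scaleCoeff P n) c
  simp only [Matrix.mulVec_sub, dotProduct_sub, sub_dotProduct, hcross', hcross]
  ring

lemma isScaleBLUE_iff_eq {P : Measure ℝ} [IsProbabilityMeasure P]
    (h : MemLp (fun x : ℝ => x) 2 P) {n : ℕ} (hS : (dispMat P n).PosDef)
    (hμ : ∀ r : ℝ, meanVec P n ≠ r • 1) (hn : 0 < n) (c : Fin n → ℝ) :
    IsScaleBLUE P c ↔ c = scaleCoeff P n := by
  obtain ⟨⟨h1, h2⟩, hmin⟩ := scaleCoeff_feasible_and_min hS hμ hn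
  have hpos (v : Fin n → ℝ) (hv : v ≠ 0) : 0 < v ⬝ᵥ (dispMat P n *ᵥ v) := by
    simpa using hS.dotProduct_mulVec_pos hv
  rw [isScaleBLUE_iff h]
  constructor
  · rintro ⟨⟨h3, h4⟩, hle⟩
    by_contra hne
    have := hle _ h1 h2
    rw [hmin c h3 h4] at this
    linarith [hpos _ (sub_ne_zero.2 hne)]
  · rintro rfl
    refine ⟨⟨h1, h2⟩, fun c' h3 h4 => ?_⟩
    rw [hmin c' h3 h4]
    rcases eq_or_ne (c' - scaleCoeff P n) 0 with h0 | h0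
    · simp [h0]
    · linarith [hpos _ h0]

/-! ### Positive definiteness of the dispersion matrix -/

section PosDef

variable {P : Measure ℝ} [IsProbabilityMeasure P]

/-- A continuous functional of the sample which is almost surely constant takes that value at every
sample drawn from an interval all of whose points lie in the support. -/
lemma eq_of_ae_eq_const {a : ℝ} {b : EReal}
    (hsupp : ∀ x y : ℝ, a < x → x < y → (y : EReal) < b → 0 < P (Set.Ioc x y))
    {g : (ℕ → ℝ) → ℝ} (hg : Continuous g) {m : ℝ} (hm : ∀ᵐ x ∂(sampleLaw P), g x = m)
    {x : ℕ → ℝ} (hx : ∀ i, a < x i ∧ (x i : EReal) < b) : g x = m := by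
  by_contra hne
  have hopen : IsOpen {y | g y ≠ m} := isOpen_ne_fun hg continuous_const
  obtain ⟨I, u, hu, hsub⟩ := isOpen_pi_iff.1 hopen x hne
  have hnull : sampleLaw P ((I : Set ℕ).pi u) = 0 := measure_mono_null hsub hm
  have hl (i : ℕ) (hi : i ∈ I) : ∃ l, a < l ∧ l < x i ∧ Set.Ioc l (x i) ⊆ u i := by
    obtain ⟨l, hl, hlu⟩ := exists_Ioc_subset_of_mem_nhds ((hu i hi).1.mem_nhds (hu i hi).2)
      ⟨a, (hx i).1⟩
    refine ⟨max l ((a + x i) / 2), ?_, max_lt hl (by linarith [(hx i).1]),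
      (Set.Ioc_subset_Ioc_left (le_max_left _ _)).trans hlu⟩
    exact lt_max_of_lt_right (by linarith [(hx i).1])
  choose! l hal hlx hlu using hl
  have hnull' : sampleLaw P ((I : Set ℕ).pi fun i => Set.Ioc (l i) (x i)) = 0 :=
    measure_mono_null (Set.pi_mono fun i hi => hlu i hi) hnull
  rw [sampleLaw, Measure.infinitePi_pi _ fun _ _ => measurableSet_Ioc,
    Finset.prod_eq_zero_iff] at hnull'
  obtain ⟨i, hi, h0⟩ := hnull'
  exact (hsupp _ _ (hal i hi) (hlx i hi) (hx i).2).ne' h0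

lemma partialMax_step {p q : ℝ} (hpq : p ≤ q) (j k : ℕ) :
    partialMax k (fun i => if i < j then p else q) = if k < j then p else q := by
  induction k with
  | zero => simp [partialMax_zero]
  | succ k ih =>
    rw [partialMax_succ, ih]
    split_ifs <;> first | omega | simp [hpq]

/-- A linear statistic of vanishing variance has vanishing coefficients: along samples jumping from
`p` to `q` at time `j` it equals `p ∑_{i<j} cᵢ + q ∑_{i≥j} cᵢ`, which does not depend on `p`. -/
lemma eq_zero_of_variance_linearStat_eq_zero (h : MemLp (fun x : ℝ => x) 2 P)
    {a : ℝ} {b : EReal} (hab : (a : EReal) < b)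
    (hsupp : ∀ x y : ℝ, a < x → x < y → (y : EReal) < b → 0 < P (Set.Ioc x y))
    {n : ℕ} {c : Fin n → ℝ} (hc : Var[linearStat c; sampleLaw P] = 0) : c = 0 := by
  have hae := ae_eq_integral_of_variance_eq_zero (memLp_linearStat h c) hc
  obtain ⟨r, har, hrb⟩ := EReal.lt_iff_exists_real_btwn.1 hab
  obtain ⟨q, hrq, hqb⟩ := EReal.lt_iff_exists_real_btwn.1 hrb
  rw [EReal.coe_lt_coe_iff] at har hrq
  set m := ∫ x, linearStat c x ∂(sampleLaw P)
  have hval (p : ℝ) (hp : a < p) (hpq : p ≤ q) (j : ℕ) :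
      linearStat c (fun i => if i < j then p else q) = m := by
    refine eq_of_ae_eq_const hsupp (continuous_linearStat c) hae fun i => ?_
    split_ifs
    · exact ⟨hp, (EReal.coe_le_coe_iff.2 hpq).trans_lt hqb⟩
    · exact ⟨hp.trans_le hpq, hqb⟩
  have hhead (j : ℕ) : ∑ i : Fin n, (if (i : ℕ) < j then c i else 0) = 0 := by
    have h1 := hval r har hrq.le j
    have h2 := hval q (har.trans hrq) le_rfl j
    simp only [linearStat, partialMax_step hrq.le, partialMax_step le_rfl] at h1 h2
    have h3 : ∑ i : Fin n, (if (i : ℕ) < j then c i else 0) * (r - q) = 0 := by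
      refine Eq.trans ?_ (sub_eq_zero.2 (h1.trans h2.symm))
      rw [← Finset.sum_sub_distrib]
      refine Finset.sum_congr rfl fun i _ => ?_
      split_ifs <;> ring
    rw [← Finset.sum_mul] at h3
    exact (mul_eq_zero.1 h3).resolve_right (sub_neg.2 hrq).ne
  funext k
  have := sub_eq_zero.2 ((hhead (k + 1)).trans (hhead k).symm)
  rw [← Finset.sum_sub_distrib, Finset.sum_eq_single k] at this
  · simpa using this
  · intro i _ hik
    have : (i : ℕ) ≠ k := fun h => hik (Fin.ext h)
    split_ifs <;> first | omega | simp
  · simp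

lemma posDef_dispMat (h : MemLp (fun x : ℝ => x) 2 P)
    {a : ℝ} {b : EReal} (hab : (a : EReal) < b)
    (hsupp : ∀ x y : ℝ, a < x → x < y → (y : EReal) < b → 0 < P (Set.Ioc x y)) (n : ℕ) :
    (dispMat P n).PosDef := by
  refine Matrix.PosDef.of_dotProduct_mulVec_pos ?_ fun v hv => ?_
  · ext i j
    simp [dispMat, covariance_comm]
  · rw [star_trivial, ← variance_linearStat h]
    exact (variance_nonneg _ _).lt_of_ne' fun h0 =>
      hv (eq_zero_of_variance_linearStat_eq_zero h hab hsupp h0)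

end PosDef

/-! ### Moments of the spacings -/

lemma measurable_ofReal_tail {P : Measure ℝ} :
    Measurable fun z => ENNReal.ofReal (1 - cdf P z) :=
  (measurable_const.sub (monotone_cdf P).measurable).ennreal_ofReal

section Moments

variable {P : Measure ℝ} [IsProbabilityMeasure P]

lemma sampleLaw_partialMax_le_lt (k : ℕ) (y z : ℝ) :
    sampleLaw P {x | partialMax k x ≤ y ∧ z < x (k + 1)} =
      ENNReal.ofReal (cdf P y ^ (k + 1)) * ENNReal.ofReal (1 - cdf P z) := by
  have hset : {x : ℕ → ℝ | partialMax k x ≤ y ∧ z < x (k + 1)} =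
      (Finset.range (k + 2) : Set ℕ).pi
        fun i => if i ≤ k then Set.Iic y else Set.Ioi z := by
    ext x
    simp only [Set.mem_ofPred_eq, partialMax_le_iff, Set.mem_pi, Finset.coe_range, Set.mem_Iio]
    constructor
    · rintro ⟨h1, h2⟩ i hi
      split_ifs with h
      · exact h1 i h
      · rwa [show i = k + 1 by omega]
    · intro h
      refine ⟨fun i hi => by simpa [hi] using h i (by omega), by simpa using h (k + 1) (by omega)⟩
  have hIoi : P (Set.Ioi z) = ENNReal.ofReal (1 - cdf P z) := by
    rw [← Set.compl_Iic, prob_compl_eq_one_sub measurableSet_Iic, ← ofReal_cdf,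
      ENNReal.ofReal_sub _ (cdf_nonneg P z), ENNReal.ofReal_one]
  rw [hset, sampleLaw, Measure.infinitePi_pi]
  · rw [Finset.prod_range_succ, if_neg (by omega), hIoi]
    congr 1
    rw [Finset.prod_congr rfl (g := fun _ => P (Set.Iic y)), Finset.prod_const,
      Finset.card_range, ← ofReal_cdf, ENNReal.ofReal_pow (cdf_nonneg P y)]
    intro i hi
    rw [if_pos (by rw [Finset.mem_range] at hi; omega)]
  · intro i _
    split_ifs
    · exact measurableSet_Iic
    · exact measurableSet_Ioi

/-- Tonelli, for `Zₖ = ∫ 1{max (X₀, …, Xₖ) ≤ y < Xₖ₊₁} dy`. -/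
lemma lintegral_spacing (k : ℕ) :
    ∫⁻ x, ENNReal.ofReal (spacing k x) ∂(sampleLaw P) =
      ∫⁻ y, ENNReal.ofReal (cdf P y ^ (k + 1)) * ENNReal.ofReal (1 - cdf P y) := by
  have hpt (x : ℕ → ℝ) : ENNReal.ofReal (spacing k x) =
      ∫⁻ y, {p : (ℕ → ℝ) × ℝ | partialMax k p.1 ≤ p.2 ∧ p.2 < p.1 (k + 1)}.indicator 1 (x, y) := by
    have : (fun y : ℝ =>
        {p : (ℕ → ℝ) × ℝ | partialMax k p.1 ≤ p.2 ∧ p.2 < p.1 (k + 1)}.indicator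
          (1 : (ℕ → ℝ) × ℝ → ENNReal) (x, y)) =
        (Set.Ico (partialMax k x) (x (k + 1))).indicator 1 := by
      ext y; simp [Set.indicator]
    rw [this, lintegral_indicator_one measurableSet_Ico, Real.volume_Ico, spacing_eq,
      ENNReal.ofReal_max, ENNReal.ofReal_zero, max_eq_left zero_le]
  have hmeas : MeasurableSet
      {p : (ℕ → ℝ) × ℝ | partialMax k p.1 ≤ p.2 ∧ p.2 < p.1 (k + 1)} := by
    refine (measurableSet_le ((measurable_partialMax k).comp measurable_fst)
      measurable_snd).inter (measurableSet_lt measurable_snd ?_)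
    exact (measurable_pi_apply (k + 1)).comp measurable_fst
  simp only [hpt]
  rw [lintegral_lintegral_swap]
  · refine lintegral_congr fun y => ?_
    rw [← sampleLaw_partialMax_le_lt, ← lintegral_indicator_one]
    · rfl
    · exact (measurableSet_le (measurable_partialMax k) measurable_const).inter
        (measurableSet_lt measurable_const (measurable_pi_apply _))
  · exact (measurable_one.indicator hmeas).aemeasurable

lemma ofReal_max_sub_zero_sq (m u : ℝ) :
    ENNReal.ofReal (max (u - m) 0 ^ 2) =
      2 * ∫⁻ y in Set.Ioi m, ENNReal.ofReal (u - y) := by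
  rcases le_total u m with h | h
  · rw [max_eq_right (by linarith), setLIntegral_congr_fun (g := fun _ => 0) measurableSet_Ioi]
    · simp
    · intro y hy
      exact ENNReal.ofReal_of_nonpos (by linarith [Set.mem_Ioi.1 hy])
  · have h0 : ∫⁻ y in Set.Ioi m, ENNReal.ofReal (u - y) =
        ∫⁻ y in Set.Ioc m u, ENNReal.ofReal (u - y) := by
      rw [← Set.Ioc_union_Ioi_eq_Ioi h, lintegral_union measurableSet_Ioi
        (Set.Ioc_disjoint_Ioi le_rfl), setLIntegral_congr_fun (g := fun _ => 0)
          measurableSet_Ioi (s := Set.Ioi u)]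
      · simp
      · intro y hy
        exact ENNReal.ofReal_of_nonpos (by linarith [Set.mem_Ioi.1 hy])
    rw [h0, ← ofReal_integral_eq_lintegral_ofReal, ← intervalIntegral.integral_of_le h,
      max_eq_left (by linarith)]
    · rw [intervalIntegral.integral_sub (by simp) (by simp), integral_id,
        intervalIntegral.integral_const, ← ENNReal.ofReal_ofNat 2,
        ← ENNReal.ofReal_mul (by norm_num)]
      congr 1
      simp only [smul_eq_mul]
      ring
    · exact (continuous_const.sub continuous_id).integrableOn_Ioc
    · filter_upwards [ae_restrict_mem measurableSet_Ioc] with y hy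
      exact sub_nonneg.2 hy.2

/-- Tonelli, for `Zₖ² = 2 ∫∫_{y < z} 1{max (X₀, …, Xₖ) ≤ y, z < Xₖ₊₁} dz dy`. -/
lemma lintegral_spacing_sq (k : ℕ) :
    ∫⁻ x, ENNReal.ofReal (spacing k x ^ 2) ∂(sampleLaw P) =
      2 * ∫⁻ y, ENNReal.ofReal (cdf P y ^ (k + 1)) *
        ∫⁻ z in Set.Ioi y, ENNReal.ofReal (1 - cdf P z) := by
  have hS : MeasurableSet {q : ((ℕ → ℝ) × ℝ) × ℝ |
      partialMax k q.1.1 ≤ q.1.2 ∧ q.1.2 < q.2 ∧ q.2 < q.1.1 (k + 1)} := by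
    refine (measurableSet_le ((measurable_partialMax k).comp
      (measurable_fst.comp measurable_fst)) (measurable_snd.comp measurable_fst)).inter
      ((measurableSet_lt (measurable_snd.comp measurable_fst) measurable_snd).inter
        (measurableSet_lt measurable_snd ?_))
    exact (measurable_pi_apply (k + 1)).comp (measurable_fst.comp measurable_fst)
  set S := {q : ((ℕ → ℝ) × ℝ) × ℝ |
      partialMax k q.1.1 ≤ q.1.2 ∧ q.1.2 < q.2 ∧ q.2 < q.1.1 (k + 1)} with hSdef
  have hSm : Measurable (S.indicator (1 : ((ℕ → ℝ) × ℝ) × ℝ → ENNReal)) :=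
    measurable_one.indicator hS
  have hpt (x : ℕ → ℝ) : ENNReal.ofReal (spacing k x ^ 2) =
      2 * ∫⁻ y, ∫⁻ z, S.indicator (1 : ((ℕ → ℝ) × ℝ) × ℝ → ENNReal) ((x, y), z) := by
    rw [spacing_eq, ofReal_max_sub_zero_sq, setLIntegral_congr Ioi_ae_eq_Ici,
      ← lintegral_indicator measurableSet_Ici]
    congr 1
    refine lintegral_congr fun y => ?_
    by_cases hy : partialMax k x ≤ y
    · have : (fun z : ℝ => S.indicator (1 : ((ℕ → ℝ) × ℝ) × ℝ → ENNReal) ((x, y), z)) =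
          (Set.Ioo y (x (k + 1))).indicator 1 := by
        ext z; simp [Set.indicator, hSdef, hy]
      rw [this, lintegral_indicator_one measurableSet_Ioo, Real.volume_Ioo,
        Set.indicator_of_mem (Set.mem_Ici.2 hy)]
    · rw [Set.indicator_of_notMem (by simpa using hy)]
      simp [Set.indicator, hSdef, hy]
  simp only [hpt]
  have hin : Measurable fun p : (ℕ → ℝ) × ℝ =>
      ∫⁻ z, S.indicator (1 : ((ℕ → ℝ) × ℝ) × ℝ → ENNReal) (p, z) := hSm.lintegral_prod_right'
  rw [lintegral_const_mul _ hin.lintegral_prod_right', lintegral_lintegral_swap hin.aemeasurable]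
  congr 1
  refine lintegral_congr fun y => ?_
  rw [lintegral_lintegral_swap, ← lintegral_const_mul _ measurable_ofReal_tail,
    ← lintegral_indicator measurableSet_Ioi]
  · refine lintegral_congr fun z => ?_
    by_cases hz : y < z
    · rw [Set.indicator_of_mem (Set.mem_Ioi.2 hz), ← sampleLaw_partialMax_le_lt,
        ← lintegral_indicator_one]
      · refine lintegral_congr fun x => ?_
        simp [Set.indicator, hSdef, hz]
      · exact (measurableSet_le (measurable_partialMax k) measurable_const).inter
          (measurableSet_lt measurable_const (measurable_pi_apply _))
    · rw [Set.indicator_of_notMem (by simpa using hz)]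
      simp [Set.indicator, hSdef, hz]
  · refine (hSm.comp ?_).aemeasurable
    exact (measurable_fst.prodMk measurable_const).prodMk measurable_snd

end Moments

/-! ### The tail of the distribution function -/

section Tail

/-- The consequences of the hypotheses on the derivative of the distribution function `F` which
the moment bounds use: on `[a, ω)`, where `1 - F ≤ e⁻¹`, the derivative of `F` lies between two
positive multiples of `(1 - F) ^ γ * (-log (1 - F)) ^ δ`, and `F` increases to `1` at `ω-`. -/
structure RegularTail (P : Measure ℝ) (δ γ a c C : ℝ) : Prop where
  lt_endpoint : (a : EReal) < upperEndpoint P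
  tail_le : 1 - cdf P a ≤ Real.exp (-1)
  lower_pos : 0 < c
  differentiableAt : ∀ x : ℝ, a ≤ x → (x : EReal) < upperEndpoint P →
    DifferentiableAt ℝ (cdf P) x
  lower : ∀ x : ℝ, a ≤ x → (x : EReal) < upperEndpoint P →
    c * ((1 - cdf P x) ^ γ * (-Real.log (1 - cdf P x)) ^ δ) ≤ deriv (cdf P) x
  upper : ∀ x : ℝ, a ≤ x → (x : EReal) < upperEndpoint P →
    deriv (cdf P) x ≤ C * ((1 - cdf P x) ^ γ * (-Real.log (1 - cdf P x)) ^ δ)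
  exists_tail_lt : ∀ ε : ℝ, 0 < ε → ∃ y : ℝ, (y : EReal) < upperEndpoint P ∧ 1 - cdf P y < ε

variable {P : Measure ℝ}

lemma cdf_lt_one_of_lt_upperEndpoint {x : ℝ} (hx : (x : EReal) < upperEndpoint P) :
    cdf P x < 1 :=
  (cdf_le_one P x).lt_of_ne fun h => hx.not_ge (sInf_le ⟨x, h, rfl⟩)

lemma exists_forall_of_eventually_leftOf {ω : EReal} {M : ℝ} (hM : (M : EReal) < ω)
    {p : ℝ → Prop} (hp : ∀ᶠ x in leftOf ω, p x) :
    ∃ a : ℝ, M < a ∧ (a : EReal) < ω ∧ ∀ x : ℝ, a ≤ x → (x : EReal) < ω → p x := by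
  obtain ⟨t, ht, hsub⟩ := mem_comap.1 hp
  obtain ⟨l, hl, hlt⟩ := (mem_nhdsLT_iff_exists_Ioo_subset' hM).1 ht
  obtain ⟨a, hla, haω⟩ := EReal.lt_iff_exists_real_btwn.1 (max_lt hM (Set.mem_Iio.1 hl))
  refine ⟨a, EReal.coe_lt_coe_iff.1 ((le_max_left _ _).trans_lt hla), haω, fun x hx hxω => ?_⟩
  exact hsub (hlt ⟨((le_max_right _ _).trans_lt hla).trans_le (EReal.coe_le_coe_iff.2 hx), hxω⟩)

lemma exists_regularTail
    (hlim : Tendsto (cdf P) (leftOf (upperEndpoint P)) (𝓝 1))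
    {M : ℝ} (hM : (M : EReal) < upperEndpoint P)
    (hdiff : ∀ x : ℝ, M < x → (x : EReal) < upperEndpoint P → DifferentiableAt ℝ (cdf P) x)
    {δ γ : ℝ}
    (hliminf : (0 : EReal) <
      liminf (fun x : ℝ => (genHazard P δ γ x : EReal)) (leftOf (upperEndpoint P)))
    (hlimsup : limsup (fun x : ℝ => (genHazard P δ γ x : EReal))
        (leftOf (upperEndpoint P)) < (⊤ : EReal)) :
    ∃ a c C : ℝ, RegularTail P δ γ a c C := by
  obtain ⟨c, hc0, hc⟩ := EReal.lt_iff_exists_real_btwn.1 hliminf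
  obtain ⟨C, hC, -⟩ := EReal.lt_iff_exists_real_btwn.1 hlimsup
  have htail : Tendsto (fun x => 1 - cdf P x) (leftOf (upperEndpoint P)) (𝓝 0) := by
    simpa using hlim.const_sub 1
  have hev : ∀ᶠ x in leftOf (upperEndpoint P), c < genHazard P δ γ x ∧
      genHazard P δ γ x < C ∧ 1 - cdf P x < Real.exp (-1) := by
    filter_upwards [eventually_lt_of_lt_liminf hc, eventually_lt_of_limsup_lt hC,
      htail.eventually_lt_const (Real.exp_pos (-1))] with x h1 h2 h3
    exact ⟨EReal.coe_lt_coe_iff.1 h1, EReal.coe_lt_coe_iff.1 h2, h3⟩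
  obtain ⟨a, hMa, haω, ha⟩ := exists_forall_of_eventually_leftOf hM hev
  have hden (x : ℝ) (hax : a ≤ x) (hx : (x : EReal) < upperEndpoint P) :
      0 < (1 - cdf P x) ^ γ * (-Real.log (1 - cdf P x)) ^ δ := by
    have h1 : 0 < 1 - cdf P x := sub_pos.2 (cdf_lt_one_of_lt_upperEndpoint hx)
    have h2 : 1 - cdf P x < 1 := (ha x hax hx).2.2.trans (Real.exp_lt_one_iff.2 (by norm_num))
    have h3 := Real.log_neg h1 h2
    exact mul_pos (Real.rpow_pos_of_pos h1 _) (Real.rpow_pos_of_pos (by linarith) _)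
  refine ⟨a, c, C, haω, (ha a le_rfl haω).2.2.le, EReal.coe_pos.1 hc0,
    fun x hx => hdiff x (hMa.trans_le hx), fun x hax hx => ?_, fun x hax hx => ?_,
    fun ε hε => ?_⟩
  · exact ((lt_div_iff₀ (hden x hax hx)).1 (ha x hax hx).1).le
  · exact ((div_lt_iff₀ (hden x hax hx)).1 (ha x hax hx).2.1).le
  · obtain ⟨y, -, hy, h⟩ :=
      exists_forall_of_eventually_leftOf hM (htail.eventually_lt_const hε)
    exact ⟨y, hy, h y le_rfl hy⟩

namespace RegularTail

variable {δ γ a c C : ℝ}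

lemma tail_pos {x : ℝ} (hx : (x : EReal) < upperEndpoint P) : 0 < 1 - cdf P x :=
  sub_pos.2 (cdf_lt_one_of_lt_upperEndpoint hx)

lemma tail_le_of_le (h : RegularTail P δ γ a c C) {x : ℝ} (hx : a ≤ x) :
    1 - cdf P x ≤ Real.exp (-1) :=
  (sub_le_sub_left (monotone_cdf P hx) 1).trans h.tail_le

lemma one_le_neg_log {t : ℝ} (ht : 0 < t) (ht' : t ≤ Real.exp (-1)) : 1 ≤ -Real.log t := by
  have := Real.log_le_log ht ht'
  rw [Real.log_exp] at this
  linarith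

lemma shape_pos {t : ℝ} (ht : 0 < t) (ht' : t ≤ Real.exp (-1)) :
    0 < t ^ γ * (-Real.log t) ^ δ :=
  mul_pos (Real.rpow_pos_of_pos ht _)
    (Real.rpow_pos_of_pos (one_pos.trans_le (one_le_neg_log ht ht')) _)

lemma deriv_pos (h : RegularTail P δ γ a c C) {x : ℝ} (hax : a ≤ x)
    (hx : (x : EReal) < upperEndpoint P) : 0 < deriv (cdf P) x :=
  (mul_pos h.lower_pos (shape_pos (tail_pos hx) (h.tail_le_of_le hax))).trans_le (h.lower x hax hx)

lemma upper_pos (h : RegularTail P δ γ a c C) : 0 < C := by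
  have h1 := (h.deriv_pos le_rfl h.lt_endpoint).trans_le (h.upper a le_rfl h.lt_endpoint)
  exact pos_of_mul_pos_left h1 (shape_pos (tail_pos h.lt_endpoint) h.tail_le).le

lemma cdf_lt_cdf (h : RegularTail P δ γ a c C) {x y : ℝ} (hax : a ≤ x) (hxy : x < y)
    (hy : (y : EReal) < upperEndpoint P) : cdf P x < cdf P y := by
  have hlt (z : ℝ) (hz : z ≤ y) : (z : EReal) < upperEndpoint P :=
    (EReal.coe_le_coe_iff.2 hz).trans_lt hy
  refine strictMonoOn_of_deriv_pos (convex_Icc x y) ?_ ?_ (Set.left_mem_Icc.2 hxy.le)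
    (Set.right_mem_Icc.2 hxy.le) hxy
  · exact fun z hz => (h.differentiableAt z (hax.trans hz.1)
      (hlt z hz.2)).continuousAt.continuousWithinAt
  · rw [interior_Icc]
    exact fun z hz => h.deriv_pos (hax.trans hz.1.le) (hlt z hz.2.le)

lemma cdf_eq_one (h : RegularTail P δ γ a c C) {x : ℝ} (hx : upperEndpoint P ≤ x) :
    cdf P x = 1 := by
  refine (cdf_le_one P x).antisymm (not_lt.1 fun hlt => ?_)
  obtain ⟨y, hy, hyx⟩ := h.exists_tail_lt _ (sub_pos.2 hlt)
  have : y ≤ x := EReal.coe_le_coe_iff.1 (hy.le.trans hx)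
  linarith [monotone_cdf P this]

lemma measurableSet_Ioo_endpoint (x : ℝ) :
    MeasurableSet {y : ℝ | x < y ∧ (y : EReal) < upperEndpoint P} :=
  measurableSet_Ioi.inter (measurable_coe_real_ereal measurableSet_Iio)

/-- The substitution `t = 1 - F y`. -/
lemma lintegral_deriv_mul_comp_tail (h : RegularTail P δ γ a c C) {x : ℝ} (hax : a ≤ x)
    (g : ℝ → ENNReal) :
    ∫⁻ y in {y : ℝ | x < y ∧ (y : EReal) < upperEndpoint P},
        ENNReal.ofReal (deriv (cdf P) y) * g (1 - cdf P y) =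
      ∫⁻ t in Set.Ioo 0 (1 - cdf P x), g t := by
  have himg : (fun y => 1 - cdf P y) '' {y : ℝ | x < y ∧ (y : EReal) < upperEndpoint P} =
      Set.Ioo 0 (1 - cdf P x) := by
    ext t
    constructor
    · rintro ⟨y, ⟨hy1, hy2⟩, rfl⟩
      exact ⟨tail_pos hy2, sub_lt_sub_left (h.cdf_lt_cdf hax hy1 hy2) 1⟩
    · rintro ⟨ht0, ht1⟩
      obtain ⟨y, hy, hyt⟩ := h.exists_tail_lt t ht0
      have hxy : x ≤ y := by
        by_contra! hlt
        linarith [monotone_cdf P hlt.le]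
      have hcont : ContinuousOn (fun y => 1 - cdf P y) (Set.Icc x y) := fun z hz =>
        continuousWithinAt_const.sub (h.differentiableAt z (hax.trans hz.1)
          ((EReal.coe_le_coe_iff.2 hz.2).trans_lt hy)).continuousAt.continuousWithinAt
      obtain ⟨z, hz, rfl⟩ := intermediate_value_Icc' hxy hcont ⟨hyt.le, ht1.le⟩
      refine ⟨z, ⟨hz.1.lt_of_ne ?_, (EReal.coe_le_coe_iff.2 hz.2).trans_lt hy⟩, rfl⟩
      rintro rfl
      exact lt_irrefl _ ht1
  rw [← himg, lintegral_image_eq_lintegral_deriv_mul_of_antitoneOn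
    (f' := fun y => -deriv (cdf P) y) (measurableSet_Ioo_endpoint x)]
  · simp only [neg_neg]
  · intro y hy
    exact ((h.differentiableAt y (hax.trans hy.1.le) hy.2).hasDerivAt.const_sub 1).hasDerivWithinAt
  · exact fun y _ z _ hyz => sub_le_sub_left (monotone_cdf P hyz) 1

end RegularTail

end Tail

/-! ### Laplace type integrals -/

section Laplace

/-- It is enough to integrate over `1 / (4 N) < t < 1 / (2 N)`, where `(1 - t) ^ N ≥ 1 / 2`. -/
lemma exists_le_lintegral_pow_mul_rpow_mul_log (γ : ℝ) {δ t₀ : ℝ} (hδ : 0 ≤ δ) (ht₀ : 0 < t₀) :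
    ∃ c : ℝ, 0 < c ∧ ∀ᶠ N : ℕ in atTop,
      ENNReal.ofReal (c * ((N : ℝ) ^ (γ - 2) * Real.log N ^ (-δ))) ≤
        ∫⁻ t in Set.Ioo 0 t₀,
          ENNReal.ofReal ((1 - t) ^ N * (t ^ (1 - γ) * (-Real.log t) ^ (-δ))) := by
  refine ⟨1 / 2 * ((1 / 4) ^ |1 - γ| * 2 ^ (-δ)) * (1 / 4), by positivity, ?_⟩
  have hlarge : ∀ᶠ N : ℕ in atTop, 1 / t₀ ≤ N :=
    tendsto_natCast_atTop_atTop.eventually_ge_atTop _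
  filter_upwards [hlarge, eventually_ge_atTop 4] with N hN1 hN4
  have hN4' : (4 : ℝ) ≤ N := by exact_mod_cast hN4
  have hN0 : (0 : ℝ) < N := by linarith
  have hlog : 0 < Real.log N := Real.log_pos (by linarith)
  have hNt : 1 ≤ N * t₀ := (div_le_iff₀ ht₀).1 hN1
  have hsub : Set.Ioo (1 / 4 / (N : ℝ)) (1 / 2 / N) ⊆ Set.Ioo 0 t₀ := by
    intro t ht
    refine ⟨lt_trans (by positivity) ht.1, ht.2.trans_le ?_⟩
    rw [div_le_iff₀ hN0]
    linarith
  have hpt (t : ℝ) (ht : t ∈ Set.Ioo (1 / 4 / (N : ℝ)) (1 / 2 / N)) :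
      1 / 2 * ((1 / 4) ^ |1 - γ| * 2 ^ (-δ)) * ((N : ℝ) ^ (γ - 1) * Real.log N ^ (-δ)) ≤
        (1 - t) ^ N * (t ^ (1 - γ) * (-Real.log t) ^ (-δ)) := by
    have ht0 : 0 < t := lt_trans (by positivity) ht.1
    have h1 : 1 / 4 < t * N := (div_lt_iff₀ hN0).1 ht.1
    have h2 : t * N < 1 / 2 := (lt_div_iff₀ hN0).1 ht.2
    have ht1 : t < 1 / 4 := by nlinarith
    have hpow : 1 / 2 ≤ (1 - t) ^ N := by
      have := one_add_mul_le_pow (show (-2 : ℝ) ≤ -t by linarith) N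
      rw [← sub_eq_add_neg] at this
      linarith
    have hrp : (1 / 4) ^ |1 - γ| * (N : ℝ) ^ (γ - 1) ≤ t ^ (1 - γ) := by
      have h3 : t ^ (1 - γ) = (t * N) ^ (1 - γ) * (N : ℝ) ^ (γ - 1) := by
        rw [Real.mul_rpow ht0.le hN0.le, mul_assoc, ← Real.rpow_add hN0]
        simp
      rw [h3]
      gcongr
      rcases le_total 0 (1 - γ) with h | h
      · rw [abs_of_nonneg h]
        exact Real.rpow_le_rpow (by norm_num) h1.le h
      · exact (Real.rpow_le_one (by norm_num) (by norm_num) (abs_nonneg _)).trans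
          (Real.one_le_rpow_of_pos_of_le_one_of_nonpos (by linarith) (by linarith) h)
    have hlt : 2 ^ (-δ) * Real.log N ^ (-δ) ≤ (-Real.log t) ^ (-δ) := by
      rw [← Real.mul_rpow (by norm_num) hlog.le]
      have h3 : 0 < -Real.log t := neg_pos.2 (Real.log_neg ht0 (by linarith))
      refine Real.rpow_le_rpow_of_nonpos h3 ?_ (by linarith)
      have h4 : 1 ≤ t * N ^ 2 := by nlinarith
      have h5 := Real.log_nonneg h4
      rw [Real.log_mul ht0.ne' (by positivity), Real.log_pow] at h5
      push_cast at h5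
      linarith
    calc _ = 1 / 2 * (((1 / 4) ^ |1 - γ| * (N : ℝ) ^ (γ - 1)) *
          (2 ^ (-δ) * Real.log N ^ (-δ))) := by ring
      _ ≤ _ := by gcongr
  have hNpow : (N : ℝ) ^ (γ - 2) = (N : ℝ) ^ (γ - 1) / N := by
    rw [← Real.rpow_sub_one hN0.ne']; congr 1; ring
  calc ENNReal.ofReal _
      = ∫⁻ _ in Set.Ioo (1 / 4 / (N : ℝ)) (1 / 2 / N), ENNReal.ofReal
          (1 / 2 * ((1 / 4) ^ |1 - γ| * 2 ^ (-δ)) * ((N : ℝ) ^ (γ - 1) * Real.log N ^ (-δ))) := by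
        rw [setLIntegral_const, Real.volume_Ioo, ← ENNReal.ofReal_mul (by positivity), hNpow]
        congr 1
        ring
    _ ≤ ∫⁻ t in Set.Ioo (1 / 4 / (N : ℝ)) (1 / 2 / N),
          ENNReal.ofReal ((1 - t) ^ N * (t ^ (1 - γ) * (-Real.log t) ^ (-δ))) :=
        setLIntegral_mono' measurableSet_Ioo fun t ht => ENNReal.ofReal_le_ofReal (hpt t ht)
    _ ≤ _ := lintegral_mono_set hsub

lemma exists_one_add_rpow_le_mul_exp {p : ℝ} (hp : 0 ≤ p) :
    ∃ K : ℝ, 0 < K ∧ ∀ s : ℝ, 0 ≤ s → (1 + s) ^ p ≤ K * Real.exp (s / 2) := by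
  refine ⟨(2 * p + 1) ^ p, by positivity, fun s hs => ?_⟩
  have h1 : 1 + s ≤ (2 * p + 1) * Real.exp (s / (2 * p + 1)) := by
    have := Real.add_one_le_exp (s / (2 * p + 1))
    have h2 : (2 * p + 1) * (s / (2 * p + 1) + 1) = s + (2 * p + 1) := by field_simp
    nlinarith
  calc (1 + s) ^ p ≤ ((2 * p + 1) * Real.exp (s / (2 * p + 1))) ^ p := by gcongr
    _ = (2 * p + 1) ^ p * Real.exp (s / (2 * p + 1) * p) := by
        rw [Real.mul_rpow (by positivity) (Real.exp_pos _).le, ← Real.exp_mul]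
    _ ≤ _ := by
        gcongr
        rw [div_mul_eq_mul_div, div_le_div_iff₀ (by positivity) (by norm_num)]
        nlinarith

lemma lintegral_Ioi_rpow_mul_exp {p r : ℝ} (hp : 0 < p) (hr : 0 < r) :
    ∫⁻ t in Set.Ioi (0 : ℝ), ENNReal.ofReal (t ^ (p - 1) * Real.exp (-(r * t))) =
      ENNReal.ofReal ((1 / r) ^ p * Real.Gamma p) := by
  have hval := Real.integral_rpow_mul_exp_neg_mul_Ioi hp hr
  rw [← hval, ofReal_integral_eq_lintegral_ofReal]
  -- integrable, as the Bochner integral does not vanish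
  · refine not_imp_comm.1 integral_undef ?_
    rw [hval]
    have := Real.Gamma_pos_of_pos hp
    positivity
  · filter_upwards [ae_restrict_mem measurableSet_Ioi] with t ht
    have := Set.mem_Ioi.1 ht
    positivity

/-- The powers of `-log t` and of `log N` are exchanged at the cost of a factor `(1 + N t) ^ (2 δ)`,
which half of the exponential `exp (-N t)` absorbs; what remains is a Gamma integral. -/
lemma exists_lintegral_pow_mul_rpow_mul_log_le {γ δ t₀ : ℝ} (hδ : 0 ≤ δ) (hγ : γ < 3 / 2)
    (ht₀ : t₀ ≤ Real.exp (-1)) :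
    ∃ K : ℝ, 0 < K ∧ ∀ N : ℕ, 2 ≤ N →
      ∫⁻ t in Set.Ioo 0 t₀,
          ENNReal.ofReal ((1 - t) ^ N * (t ^ (2 - 2 * γ) * (-Real.log t) ^ (-(2 * δ)))) ≤
        ENNReal.ofReal (K * ((N : ℝ) ^ (2 * γ - 3) * Real.log N ^ (-(2 * δ)))) := by
  obtain ⟨K, hK0, hK⟩ := exists_one_add_rpow_le_mul_exp (show 0 ≤ 2 * δ by linarith)
  have hΓ : 0 < Real.Gamma (3 - 2 * γ) := Real.Gamma_pos_of_pos (by linarith)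
  refine ⟨K * (2 ^ (3 - 2 * γ) * Real.Gamma (3 - 2 * γ)), by positivity, fun N hN => ?_⟩
  have hN2 : (2 : ℝ) ≤ N := by exact_mod_cast hN
  have hN0 : (0 : ℝ) < N := by linarith
  have hlog : 0 < Real.log N := Real.log_pos (by linarith)
  have hpt (t : ℝ) (ht : t ∈ Set.Ioo 0 t₀) :
      (1 - t) ^ N * (t ^ (2 - 2 * γ) * (-Real.log t) ^ (-(2 * δ))) ≤
        K * Real.log N ^ (-(2 * δ)) *
          (t ^ ((3 - 2 * γ) - 1) * Real.exp (-((N : ℝ) / 2 * t))) := by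
    have ht0 := ht.1
    have htN : 0 ≤ N * t := by positivity
    have hL := RegularTail.one_le_neg_log ht0 (ht.2.le.trans ht₀)
    have ht1 : t ≤ 1 := by
      by_contra! h
      linarith [Real.log_pos h]
    have hpow : (1 - t) ^ N ≤ Real.exp (-(N * t)) := by
      rw [show -((N : ℝ) * t) = N * (-t) by ring, Real.exp_nat_mul]
      gcongr
      linarith [Real.add_one_le_exp (-t)]
    -- since `-log t ≥ 1`, `log N = -log t + log (N t)` is at most `(-log t) * (1 + N t)`
    have hlogN : Real.log N ≤ -Real.log t * (1 + N * t) := by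
      have h1 : Real.log N = -Real.log t + Real.log (N * t) := by
        rw [Real.log_mul hN0.ne' ht0.ne']; ring
      have h2 : Real.log (N * t) ≤ N * t := (Real.log_le_sub_one_of_pos (by positivity)).trans
        (by linarith)
      nlinarith
    have hLd : (-Real.log t) ^ (-(2 * δ)) ≤
        Real.log N ^ (-(2 * δ)) * (1 + N * t) ^ (2 * δ) := by
      have hLpos : 0 < -Real.log t := by linarith
      have h1 := Real.rpow_le_rpow hlog.le hlogN (show 0 ≤ 2 * δ by linarith)
      rw [Real.mul_rpow hLpos.le (by positivity)] at h1
      rw [Real.rpow_neg hLpos.le, Real.rpow_neg hlog.le, inv_mul_eq_div,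
        inv_le_iff_one_le_mul₀ (by positivity), div_mul_eq_mul_div, one_le_div₀ (by positivity)]
      linarith
    have hexp := hK _ htN
    calc (1 - t) ^ N * (t ^ (2 - 2 * γ) * (-Real.log t) ^ (-(2 * δ)))
        ≤ Real.exp (-(N * t)) * (t ^ (2 - 2 * γ) *
            (Real.log N ^ (-(2 * δ)) * (K * Real.exp (N * t / 2)))) := by
          gcongr
          exact hLd.trans (by gcongr)
      _ = K * Real.log N ^ (-(2 * δ)) * (t ^ (2 - 2 * γ) *
            (Real.exp (-(N * t)) * Real.exp (N * t / 2))) := by ring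
      _ = _ := by
          rw [← Real.exp_add]
          congr 3 <;> ring
  calc _ ≤ ∫⁻ t in Set.Ioo 0 t₀, ENNReal.ofReal (K * Real.log N ^ (-(2 * δ)) *
          (t ^ ((3 - 2 * γ) - 1) * Real.exp (-((N : ℝ) / 2 * t)))) :=
        setLIntegral_mono' measurableSet_Ioo fun t ht => ENNReal.ofReal_le_ofReal (hpt t ht)
    _ ≤ ∫⁻ t in Set.Ioi 0, ENNReal.ofReal (K * Real.log N ^ (-(2 * δ)) *
          (t ^ ((3 - 2 * γ) - 1) * Real.exp (-((N : ℝ) / 2 * t)))) :=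
        lintegral_mono_set Set.Ioo_subset_Ioi_self
    _ = ENNReal.ofReal (K * Real.log N ^ (-(2 * δ))) *
          ENNReal.ofReal ((1 / ((N : ℝ) / 2)) ^ (3 - 2 * γ) * Real.Gamma (3 - 2 * γ)) := by
        simp_rw [ENNReal.ofReal_mul (show 0 ≤ K * Real.log N ^ (-(2 * δ)) by positivity)]
        rw [lintegral_const_mul' _ _ ENNReal.ofReal_ne_top,
          lintegral_Ioi_rpow_mul_exp (by linarith) (by positivity)]
    _ = _ := by
        rw [← ENNReal.ofReal_mul (by positivity)]
        congr 1
        rw [one_div_div, Real.div_rpow (by norm_num) hN0.le,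
          show 2 * γ - 3 = -(3 - 2 * γ) by ring, Real.rpow_neg hN0.le]
        ring

lemma lintegral_Ioo_rpow {p s : ℝ} (hp : 0 < p) (hs : 0 ≤ s) :
    ∫⁻ t in Set.Ioo 0 s, ENNReal.ofReal (t ^ (p - 1)) = ENNReal.ofReal (s ^ p / p) := by
  have h1 : (-1 : ℝ) < p - 1 := by linarith
  have hint := intervalIntegral.intervalIntegrable_rpow' (a := 0) (b := s) h1
  rw [setLIntegral_congr Ioo_ae_eq_Ioc, ← ofReal_integral_eq_lintegral_ofReal,
    ← intervalIntegral.integral_of_le hs, integral_rpow (Or.inl h1)]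
  · rw [sub_add_cancel, Real.zero_rpow hp.ne', sub_zero]
  · exact (intervalIntegrable_iff_integrableOn_Ioc_of_le hs).1 hint
  · filter_upwards [ae_restrict_mem measurableSet_Ioc] with t ht
    exact Real.rpow_nonneg ht.1.le _

end Laplace

/-! ### Integrals of the tail -/

namespace RegularTail

variable {P : Measure ℝ} {δ γ a c C : ℝ}

/-- Dividing by `t ^ γ (-log t) ^ δ`, the shape of the density in terms of the tail `t`. -/
lemma shape_mul_rpow {t : ℝ} (ht : 0 < t) (ht' : t ≤ Real.exp (-1)) (γ δ p q : ℝ) :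
    (t ^ γ * (-Real.log t) ^ δ) * (t ^ (p - γ) * (-Real.log t) ^ (q - δ)) =
      t ^ p * (-Real.log t) ^ q := by
  have hL : 0 < -Real.log t := one_pos.trans_le (one_le_neg_log ht ht')
  rw [mul_mul_mul_comm, ← Real.rpow_add ht, ← Real.rpow_add hL]
  simp

/-- A lower bound on the mean spacing: only the part of the integral over `(a, ω)` is kept. -/
lemma exists_le_lintegral_pow_mul_tail (h : RegularTail P δ γ a c C) (hδ : 0 ≤ δ) :
    ∃ c' : ℝ, 0 < c' ∧ ∀ᶠ N : ℕ in atTop,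
      ENNReal.ofReal (c' * ((N : ℝ) ^ (γ - 2) * Real.log N ^ (-δ))) ≤
        ∫⁻ y, ENNReal.ofReal (cdf P y ^ N) * ENNReal.ofReal (1 - cdf P y) := by
  obtain ⟨c₁, hc₁, hev⟩ :=
    exists_le_lintegral_pow_mul_rpow_mul_log γ hδ (tail_pos h.lt_endpoint)
  have hC := h.upper_pos
  refine ⟨C⁻¹ * c₁, by positivity, ?_⟩
  filter_upwards [hev] with N hN
  calc ENNReal.ofReal (C⁻¹ * c₁ * ((N : ℝ) ^ (γ - 2) * Real.log N ^ (-δ)))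
      = ENNReal.ofReal C⁻¹ * ENNReal.ofReal (c₁ * ((N : ℝ) ^ (γ - 2) * Real.log N ^ (-δ))) := by
        rw [← ENNReal.ofReal_mul (by positivity), mul_assoc]
    _ ≤ ENNReal.ofReal C⁻¹ * ∫⁻ t in Set.Ioo 0 (1 - cdf P a),
          ENNReal.ofReal ((1 - t) ^ N * (t ^ (1 - γ) * (-Real.log t) ^ (-δ))) := by gcongr
    _ = ∫⁻ y in {y : ℝ | a < y ∧ (y : EReal) < upperEndpoint P},
          ENNReal.ofReal C⁻¹ * (ENNReal.ofReal (deriv (cdf P) y) *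
            ENNReal.ofReal ((1 - (1 - cdf P y)) ^ N * ((1 - cdf P y) ^ (1 - γ) *
              (-Real.log (1 - cdf P y)) ^ (-δ)))) := by
        rw [← h.lintegral_deriv_mul_comp_tail le_rfl,
          lintegral_const_mul' _ _ ENNReal.ofReal_ne_top]
    _ ≤ ∫⁻ y in {y : ℝ | a < y ∧ (y : EReal) < upperEndpoint P},
          ENNReal.ofReal (cdf P y ^ N) * ENNReal.ofReal (1 - cdf P y) := by
        refine setLIntegral_mono' (measurableSet_Ioo_endpoint a) fun y hy => ?_
        have ht := tail_pos hy.2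
        have ht' := h.tail_le_of_le hy.1.le
        have hd := h.deriv_pos hy.1.le hy.2
        have hL : 0 < -Real.log (1 - cdf P y) := one_pos.trans_le (one_le_neg_log ht ht')
        rw [← ENNReal.ofReal_mul hd.le, ← ENNReal.ofReal_mul (by positivity),
          ← ENNReal.ofReal_mul (pow_nonneg (cdf_nonneg P y) N)]
        refine ENNReal.ofReal_le_ofReal ?_
        have hF := cdf_nonneg P y
        rw [sub_sub_cancel]
        have hsh := shape_mul_rpow ht ht' γ δ 1 0
        rw [zero_sub, Real.rpow_one, Real.rpow_zero, mul_one] at hsh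
        calc _ ≤ C⁻¹ * ((C * ((1 - cdf P y) ^ γ * (-Real.log (1 - cdf P y)) ^ δ)) *
              (cdf P y ^ N * ((1 - cdf P y) ^ (1 - γ) *
                (-Real.log (1 - cdf P y)) ^ (-δ)))) := by
              gcongr
              exact h.upper y hy.1.le hy.2
          _ = cdf P y ^ N * (((1 - cdf P y) ^ γ * (-Real.log (1 - cdf P y)) ^ δ) *
                ((1 - cdf P y) ^ (1 - γ) * (-Real.log (1 - cdf P y)) ^ (-δ))) := by
              field_simp
          _ = _ := by rw [hsh]
    _ ≤ _ := setLIntegral_le_lintegral _ _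

lemma setLIntegral_Ioi_eq (x : ℝ) {g : ℝ → ENNReal}
    (hg : ∀ z : ℝ, upperEndpoint P ≤ z → g z = 0) :
    ∫⁻ z in Set.Ioi x, g z = ∫⁻ z in {z : ℝ | x < z ∧ (z : EReal) < upperEndpoint P}, g z := by
  rw [← lintegral_indicator measurableSet_Ioi, ← lintegral_indicator (measurableSet_Ioo_endpoint x)]
  refine lintegral_congr fun z => ?_
  by_cases hz : (z : EReal) < upperEndpoint P
  · simp [Set.indicator, hz]
  · simp [Set.indicator, hg z (not_lt.1 hz)]

/-- The integrated tail satisfies `∫_x^ω (1 - F) ≤ K (1 - F x) ^ (2 - γ) (-log (1 - F x)) ^ (-δ)`. -/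
lemma lintegral_tail_le (h : RegularTail P δ γ a c C) (hδ : 0 ≤ δ) (hγ : γ < 2) {x : ℝ}
    (hax : a ≤ x) (hx : (x : EReal) < upperEndpoint P) :
    ∫⁻ z in Set.Ioi x, ENNReal.ofReal (1 - cdf P z) ≤
      ENNReal.ofReal (c⁻¹ * (2 - γ)⁻¹ *
        ((1 - cdf P x) ^ (2 - γ) * (-Real.log (1 - cdf P x)) ^ (-δ))) := by
  have hc := h.lower_pos
  have hs := tail_pos hx
  have hs' := h.tail_le_of_le hax
  have hLs : 0 < -Real.log (1 - cdf P x) := one_pos.trans_le (one_le_neg_log hs hs')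
  rw [setLIntegral_Ioi_eq x fun z hz => by simp [h.cdf_eq_one hz]]
  calc _ ≤ ∫⁻ y in {y : ℝ | x < y ∧ (y : EReal) < upperEndpoint P},
          ENNReal.ofReal (deriv (cdf P) y) * ENNReal.ofReal (c⁻¹ * ((1 - cdf P y) ^ (1 - γ) *
            (-Real.log (1 - cdf P y)) ^ (-δ))) := by
        refine setLIntegral_mono' (measurableSet_Ioo_endpoint x) fun y hy => ?_
        have hay := hax.trans hy.1.le
        have ht := tail_pos hy.2
        have ht' := h.tail_le_of_le hay
        have hL : 0 < -Real.log (1 - cdf P y) := one_pos.trans_le (one_le_neg_log ht ht')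
        rw [← ENNReal.ofReal_mul (h.deriv_pos hay hy.2).le]
        refine ENNReal.ofReal_le_ofReal ?_
        have hsh := shape_mul_rpow ht ht' γ δ 1 0
        rw [zero_sub, Real.rpow_one, Real.rpow_zero, mul_one] at hsh
        calc 1 - cdf P y = (c * ((1 - cdf P y) ^ γ * (-Real.log (1 - cdf P y)) ^ δ)) *
              (c⁻¹ * ((1 - cdf P y) ^ (1 - γ) * (-Real.log (1 - cdf P y)) ^ (-δ))) := by
              rw [mul_mul_mul_comm, hsh, mul_inv_cancel₀ hc.ne', one_mul]
          _ ≤ _ := by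
              gcongr
              exact h.lower y hay hy.2
    _ = ∫⁻ t in Set.Ioo 0 (1 - cdf P x),
          ENNReal.ofReal (c⁻¹ * (t ^ (1 - γ) * (-Real.log t) ^ (-δ))) :=
        h.lintegral_deriv_mul_comp_tail hax
          (fun t => ENNReal.ofReal (c⁻¹ * (t ^ (1 - γ) * (-Real.log t) ^ (-δ))))
    _ ≤ ∫⁻ t in Set.Ioo 0 (1 - cdf P x),
          ENNReal.ofReal (c⁻¹ * (-Real.log (1 - cdf P x)) ^ (-δ)) *
            ENNReal.ofReal (t ^ ((2 - γ) - 1)) := by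
        refine setLIntegral_mono' measurableSet_Ioo fun t ht => ?_
        have ht0 := ht.1
        rw [← ENNReal.ofReal_mul (by positivity)]
        refine ENNReal.ofReal_le_ofReal ?_
        rw [show 2 - γ - 1 = 1 - γ by ring, mul_assoc, mul_comm (t ^ (1 - γ))]
        have : (-Real.log t) ^ (-δ) ≤ (-Real.log (1 - cdf P x)) ^ (-δ) :=
          Real.rpow_le_rpow_of_nonpos hLs (neg_le_neg (Real.log_le_log ht0 ht.2.le))
            (by linarith)
        gcongr
    _ = _ := by
        rw [lintegral_const_mul' _ _ ENNReal.ofReal_ne_top,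
          lintegral_Ioo_rpow (by linarith) hs.le, ← ENNReal.ofReal_mul (by positivity)]
        congr 1
        ring

/-- The part over `(a, ω)` of the second moment of a spacing, with `N = k + 1`: the bound on the
integrated tail turns it into a Laplace type integral in `t = 1 - F`. -/
lemma exists_setLIntegral_pow_mul_lintegral_tail_le (h : RegularTail P δ γ a c C) (hδ : 0 ≤ δ)
    (hγ : γ < 3 / 2) :
    ∃ K : ℝ, 0 < K ∧ ∀ N : ℕ, 2 ≤ N →
      ∫⁻ y in Set.Ioi a, ENNReal.ofReal (cdf P y ^ N) *
          ∫⁻ z in Set.Ioi y, ENNReal.ofReal (1 - cdf P z) ≤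
        ENNReal.ofReal (K * ((N : ℝ) ^ (2 * γ - 3) * Real.log N ^ (-(2 * δ)))) := by
  obtain ⟨K₁, hK₁, hb⟩ := exists_lintegral_pow_mul_rpow_mul_log_le hδ hγ h.tail_le
  have hc := h.lower_pos
  have hγ2 : 0 < 2 - γ := by linarith
  have hγ2' : 0 < (2 - γ)⁻¹ := inv_pos.2 hγ2
  refine ⟨c⁻¹ * (c⁻¹ * (2 - γ)⁻¹) * K₁, by positivity, fun N hN => ?_⟩
  have hzero (y : ℝ) (hy : upperEndpoint P ≤ y) :
      ENNReal.ofReal (cdf P y ^ N) * ∫⁻ z in Set.Ioi y, ENNReal.ofReal (1 - cdf P z) = 0 := by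
    rw [setLIntegral_congr_fun (g := fun _ => 0) measurableSet_Ioi]
    · simp
    · intro w hw
      simp [h.cdf_eq_one (hy.trans (EReal.coe_le_coe_iff.2 (Set.mem_Ioi.1 hw).le))]
  rw [setLIntegral_Ioi_eq a hzero]
  calc _ ≤ ∫⁻ y in {y : ℝ | a < y ∧ (y : EReal) < upperEndpoint P},
          ENNReal.ofReal (deriv (cdf P) y) * (ENNReal.ofReal (c⁻¹ * (c⁻¹ * (2 - γ)⁻¹)) *
            ENNReal.ofReal ((1 - (1 - cdf P y)) ^ N * ((1 - cdf P y) ^ (2 - 2 * γ) *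
              (-Real.log (1 - cdf P y)) ^ (-(2 * δ))))) := by
        refine setLIntegral_mono' (measurableSet_Ioo_endpoint a) fun y hy => ?_
        have ht := tail_pos hy.2
        have ht' := h.tail_le_of_le hy.1.le
        have hd := h.deriv_pos hy.1.le hy.2
        have hF := cdf_nonneg P y
        have hL : 0 < -Real.log (1 - cdf P y) := one_pos.trans_le (one_le_neg_log ht ht')
        refine (mul_le_mul_right (h.lintegral_tail_le hδ (by linarith) hy.1.le hy.2) _).trans ?_
        rw [← ENNReal.ofReal_mul (by positivity), ← ENNReal.ofReal_mul (by positivity),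
          ← ENNReal.ofReal_mul hd.le]
        refine ENNReal.ofReal_le_ofReal ?_
        rw [sub_sub_cancel]
        have hsh := shape_mul_rpow ht ht' γ δ (2 - γ) (-δ)
        rw [show 2 - γ - γ = 2 - 2 * γ by ring, show -δ - δ = -(2 * δ) by ring] at hsh
        calc cdf P y ^ N * (c⁻¹ * (2 - γ)⁻¹ *
              ((1 - cdf P y) ^ (2 - γ) * (-Real.log (1 - cdf P y)) ^ (-δ)))
            = (c * ((1 - cdf P y) ^ γ * (-Real.log (1 - cdf P y)) ^ δ)) *
              (c⁻¹ * (c⁻¹ * (2 - γ)⁻¹) * (cdf P y ^ N * ((1 - cdf P y) ^ (2 - 2 * γ) *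
                (-Real.log (1 - cdf P y)) ^ (-(2 * δ))))) := by
              rw [← hsh]
              field_simp
          _ ≤ _ := by
              gcongr
              exact h.lower y hy.1.le hy.2
    _ = ∫⁻ t in Set.Ioo 0 (1 - cdf P a), ENNReal.ofReal (c⁻¹ * (c⁻¹ * (2 - γ)⁻¹)) *
          ENNReal.ofReal ((1 - t) ^ N * (t ^ (2 - 2 * γ) * (-Real.log t) ^ (-(2 * δ)))) :=
        h.lintegral_deriv_mul_comp_tail le_rfl
          (fun t => ENNReal.ofReal (c⁻¹ * (c⁻¹ * (2 - γ)⁻¹)) *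
            ENNReal.ofReal ((1 - t) ^ N * (t ^ (2 - 2 * γ) * (-Real.log t) ^ (-(2 * δ)))))
    _ ≤ ENNReal.ofReal (c⁻¹ * (c⁻¹ * (2 - γ)⁻¹)) *
          ENNReal.ofReal (K₁ * ((N : ℝ) ^ (2 * γ - 3) * Real.log N ^ (-(2 * δ)))) := by
        rw [lintegral_const_mul' _ _ ENNReal.ofReal_ne_top]
        gcongr
        exact hb N hN
    _ = _ := by
        rw [← ENNReal.ofReal_mul (by positivity), ← mul_assoc]

end RegularTail

/-! ### The moment inequality and the comparison estimator -/

section Comparison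

variable {P : Measure ℝ} [IsProbabilityMeasure P]

lemma ofReal_integral_spacing (h : MemLp (fun x : ℝ => x) 2 P) (k : ℕ) :
    ENNReal.ofReal (∫ x, spacing k x ∂(sampleLaw P)) =
      ∫⁻ y, ENNReal.ofReal (cdf P y ^ (k + 1)) * ENNReal.ofReal (1 - cdf P y) := by
  rw [ofReal_integral_eq_lintegral_ofReal ((memLp_spacing h k).integrable one_le_two)
    (ae_of_all _ (spacing_nonneg k)), lintegral_spacing]

lemma ofReal_integral_spacing_sq (h : MemLp (fun x : ℝ => x) 2 P) (k : ℕ) :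
    ENNReal.ofReal (∫ x, spacing k x ^ 2 ∂(sampleLaw P)) =
      2 * ∫⁻ y, ENNReal.ofReal (cdf P y ^ (k + 1)) *
        ∫⁻ z in Set.Ioi y, ENNReal.ofReal (1 - cdf P z) := by
  rw [ofReal_integral_eq_lintegral_ofReal (memLp_spacing h k).integrable_sq
    (ae_of_all _ fun x => sq_nonneg (spacing k x)), lintegral_spacing_sq]

/-- Cutting the second moment of a spacing at `a`: the contribution of `(-∞, a]` is geometrically
small. -/
lemma integral_spacing_sq_le (h : MemLp (fun x : ℝ => x) 2 P) (a : ℝ) (k : ℕ) {B : ℝ} (hB : 0 ≤ B)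
    (hle : ∫⁻ y in Set.Ioi a, ENNReal.ofReal (cdf P y ^ (k + 1)) *
        ∫⁻ z in Set.Ioi y, ENNReal.ofReal (1 - cdf P z) ≤ ENNReal.ofReal B) :
    ∫ x, spacing k x ^ 2 ∂(sampleLaw P) ≤
      2 * (cdf P a ^ k * (∫ x, spacing 0 x ^ 2 ∂(sampleLaw P)) + B) := by
  have hE : 0 ≤ ∫ x, spacing 0 x ^ 2 ∂(sampleLaw P) := integral_nonneg fun x => sq_nonneg _
  have hF := cdf_nonneg P a
  have h1 : ∫⁻ y in Set.Iic a, ENNReal.ofReal (cdf P y ^ (k + 1)) *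
        ∫⁻ z in Set.Ioi y, ENNReal.ofReal (1 - cdf P z) ≤
      ENNReal.ofReal (cdf P a ^ k * ∫ x, spacing 0 x ^ 2 ∂(sampleLaw P)) := by
    rw [ENNReal.ofReal_mul (by positivity), ofReal_integral_spacing_sq h]
    calc _ ≤ ∫⁻ y in Set.Iic a, ENNReal.ofReal (cdf P a ^ k) *
            (ENNReal.ofReal (cdf P y ^ (0 + 1)) *
              ∫⁻ z in Set.Ioi y, ENNReal.ofReal (1 - cdf P z)) := by
          refine setLIntegral_mono' measurableSet_Iic fun y hy => ?_
          have hy0 := cdf_nonneg P y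
          rw [← mul_assoc, ← ENNReal.ofReal_mul (by positivity)]
          gcongr
          rw [pow_succ, zero_add, pow_one]
          have hya : cdf P y ≤ cdf P a := monotone_cdf P hy
          gcongr
      _ ≤ ENNReal.ofReal (cdf P a ^ k) * ∫⁻ y, ENNReal.ofReal (cdf P y ^ (0 + 1)) *
              ∫⁻ z in Set.Ioi y, ENNReal.ofReal (1 - cdf P z) := by
          rw [lintegral_const_mul' _ _ ENNReal.ofReal_ne_top]
          exact mul_le_mul_right (setLIntegral_le_lintegral _ _) _
      _ ≤ _ := by
          gcongr
          exact le_mul_of_one_le_left zero_le one_le_two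
  rw [← ENNReal.ofReal_le_ofReal_iff (by positivity), ofReal_integral_spacing_sq h,
    ENNReal.ofReal_mul zero_le_two, ENNReal.ofReal_add (by positivity) hB, ENNReal.ofReal_ofNat,
    ← lintegral_add_compl _ (measurableSet_Iic (a := a)), Set.compl_Iic]
  gcongr

lemma eventually_mul_pow_le_rpow_mul_log {q : ℝ} (hq0 : 0 < q) (hq1 : q < 1) (B p : ℝ) {r : ℝ}
    (hr : 0 ≤ r) :
    ∀ᶠ k : ℕ in atTop, q ^ k * B ≤
      ((k + 1 : ℕ) : ℝ) ^ (-p) * Real.log ((k + 1 : ℕ) : ℝ) ^ (-r) := by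
  have hb : 0 < -Real.log q := neg_pos.2 (Real.log_neg hq0 hq1)
  have hT : Tendsto (fun k : ℕ => ((k + 1 : ℕ) : ℝ) ^ (p + r) *
      Real.exp (-(-Real.log q) * ((k + 1 : ℕ) : ℝ)) * (B / q)) atTop (𝓝 0) := by
    have := ((tendsto_rpow_mul_exp_neg_mul_atTop_nhds_zero (p + r) _ hb).comp
      (tendsto_natCast_atTop_atTop.comp (tendsto_add_atTop_nat 1))).mul_const (B / q)
    rwa [zero_mul] at this
  filter_upwards [hT.eventually_le_const one_pos, eventually_ge_atTop 1] with k hk hk1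
  have hN : (1 : ℝ) < ((k + 1 : ℕ) : ℝ) := by exact_mod_cast (by omega : 1 < k + 1)
  set N := ((k + 1 : ℕ) : ℝ) with hNdef
  have hN0 : 0 < N := by linarith
  have hexp : Real.exp (-(-Real.log q) * N) = q ^ k * q := by
    rw [neg_neg, hNdef, mul_comm, Real.exp_nat_mul, Real.exp_log hq0, pow_succ]
  have h1 : q ^ k * B ≤ N ^ (-(p + r)) := by
    rw [Real.rpow_neg hN0.le, ← one_div, le_div_iff₀ (by positivity)]
    rw [hexp] at hk
    refine le_trans (le_of_eq ?_) hk
    field_simp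
  refine h1.trans ?_
  rw [neg_add, Real.rpow_add hN0]
  refine mul_le_mul_of_nonneg_left ?_ (by positivity)
  exact Real.rpow_le_rpow_of_nonpos (Real.log_pos hN)
    ((Real.log_le_sub_one_of_pos hN0).trans (by linarith)) (by linarith)

/-- The second moment of the `k`-th spacing is at most of the order of `k` times its squared
mean. -/
lemma RegularTail.exists_integral_spacing_sq_le {δ γ a c C : ℝ} (h : RegularTail P δ γ a c C)
    (hP : MemLp (fun x : ℝ => x) 2 P) (hδ : 0 ≤ δ) (hγ : γ < 3 / 2) :
    ∃ K : ℝ, 0 < K ∧ ∀ᶠ k : ℕ in atTop, 0 < ∫ x, spacing k x ∂(sampleLaw P) ∧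
      ∫ x, spacing k x ^ 2 ∂(sampleLaw P) ≤
        K * (k + 1) * (∫ x, spacing k x ∂(sampleLaw P)) ^ 2 := by
  obtain ⟨c', hc', hlow⟩ := h.exists_le_lintegral_pow_mul_tail hδ
  obtain ⟨K, hK, hup⟩ := h.exists_setLIntegral_pow_mul_lintegral_tail_le hδ hγ
  have hq0 : 0 < cdf P a := by
    have := h.tail_le.trans_lt (Real.exp_lt_one_iff.2 (show (-1 : ℝ) < 0 by norm_num))
    linarith
  have hq1 := cdf_lt_one_of_lt_upperEndpoint h.lt_endpoint
  refine ⟨2 * (1 + K) / c' ^ 2, by positivity, ?_⟩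
  filter_upwards [(tendsto_add_atTop_nat 1).eventually hlow, eventually_ge_atTop 1,
    eventually_mul_pow_le_rpow_mul_log hq0 hq1 (∫ x, spacing 0 x ^ 2 ∂(sampleLaw P))
      (3 - 2 * γ) (show 0 ≤ 2 * δ by linarith)] with k hk hk1 hgeo
  have hN : (1 : ℝ) < ((k + 1 : ℕ) : ℝ) := by exact_mod_cast (by omega : 1 < k + 1)
  have hN0 : (0 : ℝ) < ((k + 1 : ℕ) : ℝ) := by linarith
  have hlog := Real.log_pos hN
  have hm0 : 0 ≤ ∫ x, spacing k x ∂(sampleLaw P) := integral_nonneg (spacing_nonneg k)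
  rw [← ofReal_integral_spacing hP, ENNReal.ofReal_le_ofReal_iff hm0] at hk
  have hpos : 0 < c' * (((k + 1 : ℕ) : ℝ) ^ (γ - 2) * Real.log ((k + 1 : ℕ) : ℝ) ^ (-δ)) := by
    positivity
  refine ⟨hpos.trans_le hk, ?_⟩
  have hsq := integral_spacing_sq_le hP a k (by positivity) (hup (k + 1) (by omega))
  rw [show -(3 - 2 * γ) = 2 * γ - 3 by ring] at hgeo
  have hm2 := pow_le_pow_left₀ hpos.le hk 2
  have hφ : (((k + 1 : ℕ) : ℝ) ^ (γ - 2) * Real.log ((k + 1 : ℕ) : ℝ) ^ (-δ)) ^ 2 *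
      ((k + 1 : ℕ) : ℝ) =
      ((k + 1 : ℕ) : ℝ) ^ (2 * γ - 3) * Real.log ((k + 1 : ℕ) : ℝ) ^ (-(2 * δ)) := by
    rw [mul_pow, ← Real.rpow_mul_natCast hN0.le, ← Real.rpow_mul_natCast hlog.le,
      mul_right_comm, ← Real.rpow_add_one hN0.ne']
    congr 2 <;> push_cast <;> ring
  set φ := ((k + 1 : ℕ) : ℝ) ^ (2 * γ - 3) * Real.log ((k + 1 : ℕ) : ℝ) ^ (-(2 * δ))
  set m := ∫ x, spacing k x ∂(sampleLaw P)
  calc _ ≤ 2 * (φ + K * φ) := by linarith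
    _ = 2 * (1 + K) / c' ^ 2 * ((k + 1 : ℕ) : ℝ) *
        (c' * (((k + 1 : ℕ) : ℝ) ^ (γ - 2) * Real.log ((k + 1 : ℕ) : ℝ) ^ (-δ))) ^ 2 := by
      rw [← hφ]; field_simp
    _ ≤ 2 * (1 + K) / c' ^ 2 * ((k + 1 : ℕ) : ℝ) * m ^ 2 := by gcongr
    _ = _ := by push_cast; ring

/-- Combinations of the first `n - 1` spacings are linear statistics in the first `n` partial
maxima. -/
lemma exists_linearStat_eq_sum_spacing (s : Finset ℕ) (w : ℕ → ℝ) {n : ℕ}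
    (hs : ∀ k ∈ s, k + 1 < n) :
    ∃ c : Fin n → ℝ, ∀ x, linearStat c x = ∑ k ∈ s, w k * spacing k x := by
  refine ⟨fun i => ∑ k ∈ s, w k * ((if (i : ℕ) = k + 1 then 1 else 0) -
    (if (i : ℕ) = k then 1 else 0)), fun x => ?_⟩
  simp only [linearStat, Finset.sum_mul]
  rw [Finset.sum_comm]
  refine Finset.sum_congr rfl fun k hk => ?_
  have hev (j : ℕ) (hj : j < n) :
      ∑ i : Fin n, (if (i : ℕ) = j then 1 else 0) * partialMax i x = partialMax j x := by
    rw [Finset.sum_eq_single ⟨j, hj⟩]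
    · simp
    · intro i _ hi
      rw [if_neg fun h => hi (Fin.ext h), zero_mul]
    · simp
  simp only [mul_assoc, sub_mul, ← Finset.mul_sum, Finset.sum_sub_distrib]
  rw [hev (k + 1) (hs k hk), hev k (by have := hs k hk; omega), spacing]

/-- Under NCP, a combination of spacings with nonnegative weights has variance at most the
weighted sum of the second moments. -/
lemma NCP.variance_sum_spacing_le (h : NCP P) (s : Finset ℕ) {w : ℕ → ℝ} (hw : ∀ k ∈ s, 0 ≤ w k) :
    Var[fun x => ∑ k ∈ s, w k * spacing k x; sampleLaw P] ≤
      ∑ k ∈ s, w k ^ 2 * ∫ x, spacing k x ^ 2 ∂(sampleLaw P) := by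
  rw [variance_fun_sum' fun k _ => (memLp_spacing h.memLp_two k).const_mul (w k)]
  refine Finset.sum_le_sum fun i hi => ?_
  have hself : w i ^ 2 * cov[spacing i, spacing i; sampleLaw P] ≤
      w i ^ 2 * ∫ x, spacing i x ^ 2 ∂(sampleLaw P) := by
    rw [covariance_self (measurable_spacing i).aemeasurable]
    gcongr
    exact variance_le_expectation_sq (measurable_spacing i).aestronglyMeasurable
  refine le_trans ?_ hself
  simp only [covariance_const_mul_left, covariance_const_mul_right]
  rw [← Finset.add_sum_erase s _ hi]
  refine (add_le_of_nonpos_right (Finset.sum_nonpos fun j hj => ?_)).trans (le_of_eq (by ring))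
  obtain ⟨hji, hj⟩ := Finset.mem_erase.1 hj
  exact mul_nonpos_of_nonneg_of_nonpos (hw j hj)
    (mul_nonpos_of_nonneg_of_nonpos (hw i hi) (h.cov_nonpos i j hji.symm))

lemma log_sub_log_le_sum_Ico {a b : ℕ} (hab : a ≤ b) :
    Real.log (b + 1) - Real.log (a + 1) ≤ ∑ k ∈ Finset.Ico a b, 1 / ((k : ℝ) + 1) := by
  induction b, hab using Nat.le_induction with
  | base => simp
  | succ b hab ih =>
    rw [Finset.sum_Ico_succ_top hab]
    have hb : (0 : ℝ) < b + 1 := by positivity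
    have h1 := Real.log_le_sub_one_of_pos (show 0 < ((b : ℝ) + 1 + 1) / (b + 1) by positivity)
    rw [Real.log_div (by positivity) hb.ne'] at h1
    have h2 : ((b : ℝ) + 1 + 1) / (b + 1) - 1 = 1 / (b + 1) := by field_simp; ring
    push_cast
    linarith

end Comparison

/-! ### Variance of the estimator and consistency -/

section Consistency

variable {P : Measure ℝ} [IsProbabilityMeasure P]

lemma RegularTail.measure_Ioc_pos {δ γ a c C : ℝ} (h : RegularTail P δ γ a c C) (x y : ℝ)
    (hax : a < x) (hxy : x < y) (hy : (y : EReal) < upperEndpoint P) : 0 < P (Set.Ioc x y) := by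
  rw [← measure_cdf P, StieltjesFunction.measure_Ioc, ENNReal.ofReal_pos, sub_pos]
  exact h.cdf_lt_cdf hax.le hxy hy

/-- If the mean vector were constant, the first spacing would be null, contradicting the positive
definiteness of the dispersion matrix. -/
lemma meanVec_ne_smul_one (h : MemLp (fun x : ℝ => x) 2 P) {n : ℕ} (hn : 2 ≤ n)
    (hS : (dispMat P n).PosDef) (r : ℝ) : meanVec P n ≠ r • 1 := by
  intro hr
  have h0 : ∫ x, partialMax 0 x ∂(sampleLaw P) = r := by
    simpa [meanVec] using congrFun hr ⟨0, by omega⟩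
  have h1 : ∫ x, partialMax 1 x ∂(sampleLaw P) = r := by
    simpa [meanVec] using congrFun hr ⟨1, by omega⟩
  have hZ : ∫ x, spacing 0 x ∂(sampleLaw P) = 0 := by
    unfold spacing
    rw [integral_sub ((memLp_partialMax h _).integrable one_le_two)
      ((memLp_partialMax h _).integrable one_le_two), zero_add, h0, h1, sub_self]
  rw [integral_eq_zero_iff_of_nonneg (spacing_nonneg 0)
    ((memLp_spacing h 0).integrable one_le_two)] at hZ
  obtain ⟨c, hc⟩ := exists_linearStat_eq_sum_spacing {0} 1 (n := n) (by simp; omega)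
  simp only [Finset.sum_singleton, Pi.one_apply, one_mul] at hc
  have hvar : Var[linearStat c; sampleLaw P] = 0 := by
    rw [funext hc, variance_congr hZ, variance_zero]
  rw [variance_linearStat h] at hvar
  have hc0 : c = 0 := by
    by_contra hne
    have := hS.dotProduct_mulVec_pos hne
    rw [star_trivial, hvar] at this
    exact lt_irrefl _ this
  have := hc (fun i => (i : ℝ))
  simp [hc0, linearStat, spacing, partialMax_succ, partialMax_zero] at this

/-- Comparing the BLUE with an unbiased combination of spacings. -/
lemma variance_scaleCoeff_le (h : NCP P) {n : ℕ}
    (hblue : IsScaleBLUE P (scaleCoeff P n)) {s : Finset ℕ} (hs : ∀ k ∈ s, k + 1 < n)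
    {w : ℕ → ℝ} (hw : ∀ k ∈ s, 0 ≤ w k)
    (hsum : ∑ k ∈ s, w k * ∫ x, spacing k x ∂(sampleLaw P) = 1) :
    Var[linearStat (scaleCoeff P n); sampleLaw P] ≤
      ∑ k ∈ s, w k ^ 2 * ∫ x, spacing k x ^ 2 ∂(sampleLaw P) := by
  obtain ⟨c, hc⟩ := exists_linearStat_eq_sum_spacing s w hs
  have hc1 : c ⬝ᵥ 1 = 0 := by
    -- evaluate at the constant sample `1`, whose spacings vanish
    have hone (k : ℕ) : partialMax k (fun _ => (1 : ℝ)) = 1 := by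
      induction k with
      | zero => exact partialMax_zero _
      | succ k ih => rw [partialMax_succ, ih, max_self]
    have := hc (fun _ => 1)
    simpa [linearStat, spacing, hone, dotProduct] using this
  have hc2 : c ⬝ᵥ meanVec P n = 1 := by
    rw [← integral_linearStat h.memLp_two, funext hc, integral_finsetSum, ← hsum]
    · simp only [integral_const_mul]
    · exact fun k _ => ((memLp_spacing h.memLp_two k).integrable one_le_two).const_mul _
  have hmin := ((isScaleBLUE_iff h.memLp_two _).1 hblue).2 c hc1 hc2
  rw [← variance_linearStat h.memLp_two, ← variance_linearStat h.memLp_two] at hmin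
  refine hmin.trans ?_
  rw [funext hc]
  exact h.variance_sum_spacing_le s hw

/-- With weights proportional to `1 / ((k + 1) E Z_k)` the comparison estimator has variance at most
a multiple of the inverse of a harmonic sum. -/
lemma exists_eventually_variance_scaleCoeff_le (h : NCP P)
    (hblue : ∀ n : ℕ, 2 ≤ n → IsScaleBLUE P (scaleCoeff P n)) {K : ℝ} (hK : 0 < K)
    (hmom : ∀ᶠ k : ℕ in atTop, 0 < ∫ x, spacing k x ∂(sampleLaw P) ∧
      ∫ x, spacing k x ^ 2 ∂(sampleLaw P) ≤
        K * (k + 1) * (∫ x, spacing k x ∂(sampleLaw P)) ^ 2) :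
    ∀ᶠ n : ℕ in atTop,
      Var[linearStat (scaleCoeff P n); sampleLaw P] ≤ 2 * K * (1 / Real.log n) := by
  obtain ⟨k₀, hk₀⟩ := eventually_atTop.1 hmom
  have hlogs : ∀ᶠ n : ℕ in atTop, 2 * Real.log (k₀ + 1) ≤ Real.log n :=
    (Real.tendsto_log_atTop.comp tendsto_natCast_atTop_atTop).eventually_ge_atTop _
  filter_upwards [hlogs, eventually_ge_atTop 2, eventually_gt_atTop k₀] with n hn hn2 hnk
  have hlog : 0 < Real.log n := Real.log_pos (by exact_mod_cast hn2)
  set s := Finset.Ico k₀ (n - 1)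
  set S := ∑ k ∈ s, 1 / ((k : ℝ) + 1)
  have hS : Real.log n / 2 ≤ S := by
    have := log_sub_log_le_sum_Ico (show k₀ ≤ n - 1 by omega)
    rw [Nat.cast_sub (by omega), Nat.cast_one, sub_add_cancel] at this
    linarith
  have hS0 : 0 < S := by linarith
  have hm (k : ℕ) (hk : k ∈ s) := hk₀ k (Finset.mem_Ico.1 hk).1
  refine (variance_scaleCoeff_le h (hblue n hn2) (s := s)
    (w := fun k => S⁻¹ * (1 / ((k : ℝ) + 1)) * (∫ x, spacing k x ∂(sampleLaw P))⁻¹)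
    ?_ ?_ ?_).trans ?_
  · intro k hk
    have := Finset.mem_Ico.1 hk
    omega
  · intro k hk
    have := (hm k hk).1
    positivity
  · have : ∀ k ∈ s, S⁻¹ * (1 / ((k : ℝ) + 1)) * (∫ x, spacing k x ∂(sampleLaw P))⁻¹ *
        (∫ x, spacing k x ∂(sampleLaw P)) = S⁻¹ * (1 / ((k : ℝ) + 1)) := fun k hk =>
      inv_mul_cancel_right₀ (hm k hk).1.ne' _
    rw [Finset.sum_congr rfl this, ← Finset.mul_sum, inv_mul_cancel₀ hS0.ne']
  · calc _ ≤ ∑ k ∈ s, S⁻¹ ^ 2 * K * (1 / ((k : ℝ) + 1)) := by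
          refine Finset.sum_le_sum fun k hk => ?_
          obtain ⟨h1, h2⟩ := hm k hk
          refine (mul_le_mul_of_nonneg_left h2 (sq_nonneg _)).trans (le_of_eq ?_)
          field_simp
      _ = S⁻¹ * K := by
          rw [← Finset.mul_sum, sq]
          change S⁻¹ * S⁻¹ * K * S = _
          field_simp
      _ ≤ (Real.log n / 2)⁻¹ * K := by gcongr
      _ = _ := by field_simp

lemma memLp_locationScale (h : MemLp (fun x : ℝ => x) 2 P) (θ₁ θ₂ : ℝ) :
    MemLp (fun x : ℝ => x) 2 (locationScale P θ₁ θ₂) := by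
  have hm : Measurable fun x : ℝ => θ₁ + θ₂ * x := by fun_prop
  exact (memLp_map_measure_iff aestronglyMeasurable_id hm.aemeasurable).2
    ((memLp_const θ₁).add (h.const_mul θ₂))

instance (θ₁ θ₂ : ℝ) : IsProbabilityMeasure (locationScale P θ₁ θ₂) :=
  Measure.isProbabilityMeasure_map (by fun_prop)

/-- An estimator sequence with constant mean and vanishing variance is consistent. -/
lemma tendstoInMeasure_of_tendsto_variance {Ω : Type*} [MeasurableSpace Ω] {Q : Measure Ω}
    [IsFiniteMeasure Q] {T : ℕ → Ω → ℝ} {θ : ℝ} (hT : ∀ n, MemLp (T n) 2 Q)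
    (hmean : ∀ᶠ n in atTop, ∫ w, T n w ∂Q = θ)
    (hvar : Tendsto (fun n => Var[T n; Q]) atTop (𝓝 0)) :
    TendstoInMeasure Q T atTop (fun _ => θ) := by
  rw [tendstoInMeasure_iff_dist]
  intro ε hε
  have hlim : Tendsto (fun n => ENNReal.ofReal (Var[T n; Q] / ε ^ 2)) atTop (𝓝 0) := by
    simpa using ENNReal.tendsto_ofReal (hvar.div_const (ε ^ 2))
  refine tendsto_of_tendsto_of_tendsto_of_le_of_le' tendsto_const_nhds hlim
    (Eventually.of_forall fun _ => zero_le) ?_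
  filter_upwards [hmean] with n hn
  have := meas_ge_le_variance_div_sq (hT n) hε
  rw [hn] at this
  simpa only [Real.dist_eq] using this

end Consistency

end PartialMaxima

theorem theorem5p2
    (P : Measure ℝ) [IsProbabilityMeasure P] (hNCP : PartialMaxima.NCP P)
    (hlim : Tendsto (cdf P) (PartialMaxima.leftOf (PartialMaxima.upperEndpoint P)) (𝓝 1))
    (M : ℝ) (hM : (M : EReal) < PartialMaxima.upperEndpoint P)
    (hdiff : ∀ x : ℝ, M < x → (x : EReal) < PartialMaxima.upperEndpoint P →
      DifferentiableAt ℝ (cdf P) x)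
    (δ γ : ℝ) (hδγ : (γ < 3 / 2 ∧ δ = 0) ∨ (0 < δ ∧ 1 / 2 < γ ∧ γ ≤ 1))
    (hliminf : (0 : EReal) <
      liminf (fun x : ℝ => (PartialMaxima.genHazard P δ γ x : EReal))
        (PartialMaxima.leftOf (PartialMaxima.upperEndpoint P)))
    (hlimsup : limsup (fun x : ℝ => (PartialMaxima.genHazard P δ γ x : EReal))
        (PartialMaxima.leftOf (PartialMaxima.upperEndpoint P)) < (⊤ : EReal)) :
    -- for `n ≥ 2`, `L₂` is the unique BLUE of the scale parameter
    (∀ n : ℕ, 2 ≤ n → ∀ c : Fin n → ℝ,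
      PartialMaxima.IsScaleBLUE P c ↔ c = PartialMaxima.scaleCoeff P n) ∧
    -- for an i.i.d. sample `X` from any member of the location-scale family,
    -- `L₂` is consistent for `θ₂` and has variance `O(1 / log n)`
    (∀ (θ₁ θ₂ : ℝ), 0 < θ₂ →
      ∀ (Ω : Type*) [MeasurableSpace Ω] (Q : Measure Ω) [IsProbabilityMeasure Q]
        (X : ℕ → Ω → ℝ), (∀ k, Measurable (X k)) → iIndepFun X Q →
        (∀ k, Q.map (X k) = PartialMaxima.locationScale P θ₁ θ₂) →
        TendstoInMeasure Q
          (fun n w => PartialMaxima.scaleEstimator P n (fun k => X k w)) atTop (fun _ => θ₂) ∧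
        (fun n : ℕ => Var[fun w => PartialMaxima.scaleEstimator P n (fun k => X k w); Q])
          =O[atTop] (fun n : ℕ => 1 / Real.log (n : ℝ))) := by
  have hδ : 0 ≤ δ := by rcases hδγ with ⟨-, rfl⟩ | ⟨h, -⟩ <;> linarith
  have hγ : γ < 3 / 2 := by rcases hδγ with ⟨h, -⟩ | ⟨-, -, h⟩ <;> linarith
  have hP := hNCP.memLp_two
  obtain ⟨a, c, C, hreg⟩ := PartialMaxima.exists_regularTail hlim hM hdiff hliminf hlimsup
  have hpos (n : ℕ) : (PartialMaxima.dispMat P n).PosDef :=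
    PartialMaxima.posDef_dispMat hP hreg.lt_endpoint hreg.measure_Ioc_pos n
  have hblue (n : ℕ) (hn : 2 ≤ n) (c : Fin n → ℝ) :
      PartialMaxima.IsScaleBLUE P c ↔ c = PartialMaxima.scaleCoeff P n :=
    PartialMaxima.isScaleBLUE_iff_eq hP (hpos n)
      (PartialMaxima.meanVec_ne_smul_one hP hn (hpos n)) (by omega) c
  have hbest (n : ℕ) (hn : 2 ≤ n) := (hblue n hn _).2 rfl
  refine ⟨hblue, fun θ₁ θ₂ hθ Ω _ Q _ X hX hindep hlaw => ?_⟩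
  obtain ⟨K, hK, hmom⟩ := hreg.exists_integral_spacing_sq_le hP hδ hγ
  have hvar := PartialMaxima.exists_eventually_variance_scaleCoeff_le hNCP hbest hK hmom
  have hmeas : Measurable fun w k => X k w := measurable_pi_lambda _ hX
  have hmap : Q.map (fun w k => X k w) =
      PartialMaxima.sampleLaw (PartialMaxima.locationScale P θ₁ θ₂) := by
    rw [(iIndepFun_iff_map_fun_eq_infinitePi_map hX).1 hindep, PartialMaxima.sampleLaw]
    simp only [hlaw]
  have hstat (n : ℕ) : Var[fun w => PartialMaxima.scaleEstimator P n (fun k => X k w); Q] =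
      θ₂ ^ 2 * Var[PartialMaxima.linearStat (PartialMaxima.scaleCoeff P n);
        PartialMaxima.sampleLaw P] := by
    rw [← PartialMaxima.variance_linearStat_locationScale _ θ₁ hθ, ← hmap,
      variance_map (PartialMaxima.continuous_linearStat _).aemeasurable hmeas.aemeasurable]
    rfl
  have hO : (fun n : ℕ => Var[fun w => PartialMaxima.scaleEstimator P n (fun k => X k w); Q])
      =O[atTop] (fun n : ℕ => 1 / Real.log (n : ℝ)) := by
    refine IsBigO.of_bound (θ₂ ^ 2 * (2 * K)) ?_
    filter_upwards [hvar] with n hn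
    rw [Real.norm_of_nonneg (variance_nonneg _ _), hstat, mul_assoc,
      Real.norm_of_nonneg (one_div_nonneg.2 (Real.log_natCast_nonneg n))]
    gcongr
  refine ⟨PartialMaxima.tendstoInMeasure_of_tendsto_variance (fun n => ?_) ?_ ?_, hO⟩
  · refine MemLp.comp_of_map ?_ hmeas.aemeasurable
    rw [hmap]
    exact PartialMaxima.memLp_linearStat (PartialMaxima.memLp_locationScale hP θ₁ θ₂) _
  · filter_upwards [eventually_ge_atTop 2] with n hn
    rw [← (hbest n hn).1 θ₁ θ₂ hθ, ← hmap, integral_map hmeas.aemeasurable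
      (PartialMaxima.continuous_linearStat _).aestronglyMeasurable]
    rfl
  · refine hO.trans_tendsto ?_
    simpa only [one_div, Function.comp_def] using tendsto_inv_atTop_zero.comp
      (Real.tendsto_log_atTop.comp tendsto_natCast_atTop_atTop)
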